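/- Let $I\subseteq\mathbb R$ be a nonempty open interval and let $c,p,s\in C^\infty(I)$ with $c(u)\neq0$ for all $u\in I$. Work with local functionals $\int h\,dx$, where $h$ is a differential polynomial (a polynomial in $u_x,u_{xx},\dots$ with coefficients in $C^\infty(I)$), taken modulo total $x$-derivatives, and with everything taken modulo $O(\epsilon^6)$. The grading is $\deg u^{(n)}=n$ for $n\ge1$, and functions of $u$ have degree $0$. For $f\in C^\infty(I)$ put $H_f=\int h_f\,dx$, $$h_f=f-\frac{\epsilon^2}{24}\,c\,f'''u_x^2+\epsilon^4\Big[\Big(p f'''+\frac{c^2f^{(4)}}{480}\Big)u_{xx}^2-\Big(\frac{c\,c''f^{(4)}}{1152}+\frac{c\,c'f^{(5)}}{1152}+\frac{c^2f^{(6)}}{3456}+\frac{p'f^{(4)}}6+\frac{p f^{(5)}}6-s f'''\Big)u_x^4\Big].$$ Let $q\in C^\infty(I)$ with $q'(u)\ne 0$ for all $u\in I$. A *bihamiltonian structure of the family $(H_f)$ deforming the pencil* $\{u(x),u(y)\}_1=\delta'(x-y)$, $\{u(x),u(y)\}^{[0]}_2=q(u)\delta'(x-y)+\frac12q'(u)u_x\delta(x-y)$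 is a bracket $$\{u(x),u(y)\}_2=\{u(x),u(y)\}_2^{[0]}+\sum_{n=1}^{5}\epsilon^n\sum_{j=0}^{n+1}A_{n,j}(u;u_x,\dots)\,\delta^{(j)}(x-y)+O(\epsilon^6),$$ with $A_{n,j}$ a homogeneous differential polynomial of degree $n+1-j$, such that, modulo $O(\epsilon^6)$, $\{\,,\}_1$ and all $\{\,,\}_2-\lambda\{\,,\}_1$ ($\lambda\in\mathbb R$) are Poisson brackets (antisymmetric and satisfying the Jacobi identity on local functionals), and $\{H_f,H_g\}_1=\{H_f,H_g\}_2=O(\epsilon^6)$ for all $f,g\in C^\infty(I)$. Then: 1. For given $q$ such a structure exists if and only if $$p=\frac{c^2}{960}\Big[5\,\frac{c'}{c}-\frac{q''}{q'}\Big]\quad\text{on } I,$$ and in that case it is unique (modulo $O(\epsilon^6)$). This holds for every $s$, in particular in the normalization $s=0$. 2. For every $c,p,s$ as above there is a $q$ with nowhere vanishing $q'$ for which such a structure exists. The resulting pencil is unique: if $\{\,,\}_2$ and $\widetilde{\{\,,\}}_2$ are such structures for $q$ and $\tilde q$, then there are real constants $a\ne0$ and $b$ with $\tilde q=a q+b$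 and $\widetilde{\{\,,\}}_2=a\{\,,\}_2+b\{\,,\}_1$. 3. For such a structure, all flows are Hamiltonian with respect to both brackets: if $f''=q\,g''+\frac12q'g'$, then $\{u(x),H_f\}_1=\{u(x),H_g\}_2$ modulo $O(\epsilon^6)$. -/

import Mathlib

open TopologicalSpace
open scoped ContDiff

namespace BiHam

noncomputable section

/-- The smooth real functions on an open set `I ⊆ ℝ`, as a subalgebra of all functions. -/
def smoothSubalgebra (I : Opens ℝ) : Subalgebra ℝ (I → ℝ) where
  carrier := {f | ∃ g : ℝ → ℝ, ContDiffOn ℝ ∞ g I ∧ ∀ u : I, f u = g u}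
  mul_mem' := by
    rintro _ _ ⟨g, hg, hfg⟩ ⟨k, hk, hfk⟩
    exact ⟨fun x => g x * k x, hg.mul hk, fun u => by simp [hfg u, hfk u]⟩
  add_mem' := by
    rintro _ _ ⟨g, hg, hfg⟩ ⟨k, hk, hfk⟩
    exact ⟨fun x => g x + k x, hg.add hk, fun u => by simp [hfg u, hfk u]⟩
  algebraMap_mem' r := ⟨fun _ => r, contDiffOn_const, fun _ => rfl⟩

/-- The algebra `C^∞(I)`. -/
def Smooth (I : Opens ℝ) : Type := smoothSubalgebra I

instance (I : Opens ℝ) : CommRing (Smooth I) := inferInstanceAs (CommRing (smoothSubalgebra I))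

instance (I : Opens ℝ) : Algebra ℝ (Smooth I) := inferInstanceAs (Algebra ℝ (smoothSubalgebra I))

instance (I : Opens ℝ) : CoeFun (Smooth I) (fun _ => I → ℝ) := ⟨Subtype.val⟩

/-- The derivative `f ↦ f'` of smooth functions on `I`. -/
def der {I : Opens ℝ} (f : Smooth I) : Smooth I :=
  ⟨fun u => deriv (Function.extend Subtype.val (f : I → ℝ) 0) u, by
    obtain ⟨f, g, hg, hfg⟩ := f
    refine ⟨deriv g, ((contDiffOn_infty_iff_deriv_of_isOpen I.isOpen).1 hg).2, fun u => ?_⟩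
    apply Filter.EventuallyEq.deriv_eq
    filter_upwards [I.isOpen.mem_nhds u.2] with x hx
    exact (Subtype.val_injective.extend_apply f 0 ⟨x, hx⟩).trans (hfg ⟨x, hx⟩)⟩

/-- Differential polynomials in one field `u`: polynomials in `u_x, u_xx, …` whose coefficients
are smooth functions of `u ∈ I`.  The variable `X n` stands for the derivative `u^{(n+1)}`. -/
abbrev DiffPoly (I : Opens ℝ) : Type := MvPolynomial ℕ (Smooth I)

/-- A function of `u`, viewed as a differential polynomial. -/
def fn {I : Opens ℝ} (f : Smooth I) : DiffPoly I := MvPolynomial.C f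

/-- The jet variable `u^{(n+1)}`; thus `jet 0 = u_x` and `jet 1 = u_xx`. -/
def jet {I : Opens ℝ} (n : ℕ) : DiffPoly I := MvPolynomial.X n

/-- `∂F/∂u`: the coefficients of `F` are differentiated. -/
def partialU {I : Opens ℝ} (F : DiffPoly I) : DiffPoly I :=
  ∑ m ∈ F.support, MvPolynomial.monomial m (der (F.coeff m))

/-- The total `x`-derivative
`∂_x F = u_x ∂F/∂u + ∑_{n ≥ 1} u^{(n+1)} ∂F/∂u^{(n)}`. -/
def totalD {I : Opens ℝ} (F : DiffPoly I) : DiffPoly I :=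
  jet 0 * partialU F + ∑ n ∈ F.vars, jet (n + 1) * MvPolynomial.pderiv n F

/-- The variational derivative (Euler–Lagrange operator)
`δ/δu(x) ∫ F dx = ∂F/∂u + ∑_{n ≥ 1} (-∂_x)^n ∂F/∂u^{(n)}`. -/
def varD {I : Opens ℝ} (F : DiffPoly I) : DiffPoly I :=
  partialU F + ∑ n ∈ F.vars, (-1) ^ (n + 1) * totalD^[n + 1] (MvPolynomial.pderiv n F)

/-- `F` has degree `d` for the grading `deg u^{(n)} = n` (`n ≥ 1`), functions of `u` having
degree `0`. -/
def HasDegree {I : Opens ℝ} (F : DiffPoly I) (d : ℕ) : Prop :=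
  MvPolynomial.IsWeightedHomogeneous (fun n : ℕ => n + 1) F d

/-- Differential operators `∑_j A_j ∂_x^j`, given by their coefficients.  The operator with
coefficients `A_j` encodes the local bivector `{u(x), u(y)} = ∑_j A_j(u; u_x, …) δ^{(j)}(x - y)`. -/
abbrev DiffOp (I : Opens ℝ) : Type := ℕ →₀ DiffPoly I

/-- The action of a differential operator. -/
def DiffOp.act {I : Opens ℝ} (A : DiffOp I) (F : DiffPoly I) : DiffPoly I :=
  A.sum fun j a => a * totalD^[j] F

/-- Series `∑_{n ≤ 5} ε^n a_n` modulo `O(ε^6)`. -/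
abbrev Ser (R : Type) : Type := Fin 6 → R

/-- The product of series modulo `O(ε^6)`, for a given product of coefficients. -/
def Ser.conv {R S T : Type} [AddCommMonoid T] (m : R → S → T) (a : Ser R) (b : Ser S) : Ser T :=
  fun n => ∑ i : Fin 6, ∑ j : Fin 6, if (i : ℕ) + (j : ℕ) = (n : ℕ) then m (a i) (b j) else 0

/-- The local functional `∫ F dx` vanishes modulo `O(ε^6)`: the density is a total derivative. -/
def IsNull {I : Opens ℝ} (F : Ser (DiffPoly I)) : Prop :=
  ∀ n, ∃ Q : DiffPoly I, F n = totalD Q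

/-- `{u(x), ∫ G dx} = L (δG/δu)` modulo `O(ε^6)`. -/
def field {I : Opens ℝ} (L : Ser (DiffOp I)) (G : Ser (DiffPoly I)) : Ser (DiffPoly I) :=
  Ser.conv DiffOp.act L (fun j => varD (G j))

/-- A density of the bracket `{∫ F dx, ∫ G dx} = ∫ (δF/δu) L (δG/δu) dx` modulo `O(ε^6)`. -/
def bracket {I : Opens ℝ} (L : Ser (DiffOp I)) (F G : Ser (DiffPoly I)) : Ser (DiffPoly I) :=
  Ser.conv (fun a b => a * b) (fun i => varD (F i)) (field L G)

/-- `L` defines a Poisson bracket modulo `O(ε^6)`: the bracket of local functionals is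
antisymmetric and satisfies the Jacobi identity. -/
structure IsPoisson {I : Opens ℝ} (L : Ser (DiffOp I)) : Prop where
  antisymm : ∀ F G, IsNull (bracket L F G + bracket L G F)
  jacobi : ∀ F G H, IsNull (bracket L (bracket L F G) H + bracket L (bracket L G H) F
    + bracket L (bracket L H F) G)

/-- The first bracket `{u(x), u(y)}_1 = δ'(x - y)`. -/
def firstOp (I : Opens ℝ) : Ser (DiffOp I) :=
  fun n => if n = 0 then Finsupp.single 1 1 else 0

/-- The undeformed second bracket `q(u) δ'(x - y) + ½ q'(u) u_x δ(x - y)`. -/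
def secondOp {I : Opens ℝ} (q : Smooth I) : DiffOp I :=
  Finsupp.single 1 (fn q) + Finsupp.single 0 (fn ((1 / 2 : ℝ) • der q) * jet 0)

/-- `L` is a deformation of `A`: `L = A + ∑_{n ≥ 1} ε^n L_n` where the coefficient of
`δ^{(j)}(x - y)` in `L_n` is a differential polynomial of degree `n + 1 - j`, and is zero
when `j > n + 1`. -/
structure IsDeformation {I : Opens ℝ} (A : DiffOp I) (L : Ser (DiffOp I)) : Prop where
  leading : L 0 = A
  graded : ∀ (n : Fin 6) (j : ℕ), L n j ≠ 0 → ∃ d : ℕ, d + j = (n : ℕ) + 1 ∧ HasDegree (L n j) d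

/-- The Hamiltonian density `h_f` with functional parameters `c, p, s`:
`f - ε²/24 c f''' u_x² + ε⁴ [(p f''' + c² f⁽⁴⁾/480) u_xx² - (c c'' f⁽⁴⁾/1152 + c c' f⁽⁵⁾/1152
  + c² f⁽⁶⁾/3456 + p' f⁽⁴⁾/6 + p f⁽⁵⁾/6 - s f''') u_x⁴]`. -/
def ham {I : Opens ℝ} (c p s f : Smooth I) : Ser (DiffPoly I) :=
  ![fn f,
    0,
    -fn ((1 / 24 : ℝ) • (c * der^[3] f)) * jet 0 ^ 2,
    0,
    fn (p * der^[3] f + (1 / 480 : ℝ) • (c ^ 2 * der^[4] f)) * jet 1 ^ 2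
      - fn ((1 / 1152 : ℝ) • (c * der^[2] c * der^[4] f)
          + (1 / 1152 : ℝ) • (c * der c * der^[5] f)
          + (1 / 3456 : ℝ) • (c ^ 2 * der^[6] f)
          + (1 / 6 : ℝ) • (der p * der^[4] f)
          + (1 / 6 : ℝ) • (p * der^[5] f)
          - s * der^[3] f) * jet 0 ^ 4,
    0]

/-- `L` is, modulo `O(ε^6)`, the second bracket of a bihamiltonian structure of the Hamiltonians
`H_f`, deforming the pencil `δ'`, `q δ' + ½ q' u_x δ`, with first bracket `δ'`:
`{ , }_2 - λ { , }_1` is a Poisson bracket for all `λ`, and the `H_f` commute pairwise with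
respect to both brackets. -/
structure IsBihamiltonian {I : Opens ℝ} (c p s q : Smooth I) (L : Ser (DiffOp I)) : Prop where
  deformation : IsDeformation (secondOp q) L
  first : IsPoisson (firstOp I)
  pencil : ∀ l : ℝ, IsPoisson (L - l • firstOp I)
  commute_first : ∀ f g, IsNull (bracket (firstOp I) (ham c p s f) (ham c p s g))
  commute_second : ∀ f g, IsNull (bracket L (ham c p s f) (ham c p s g))

end

end BiHam

/-! Everything rests on two test principles. A differential polynomial `Y` of degree at least two
with `∫ f(u) Y dx = 0` for all functions `f` is zero (`eq_zero_of_loc_fn_mul`), and a differential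
operator that kills all functions of `u` is zero (`diffOp_eq_zero`). The gradient of `H_f` begins
with `f'`, and on an interval every function is some `f'`, so the Hamiltonians supply all test
functions and their relations can be exploited order by order in `ε`.

Commutation therefore implies the Poisson property: if all `H_f` commute under a deformation `L`,
then `L` is skew and satisfies Jacobi, because Jacobi is trivial on commuting Hamiltonians and the
trivector is determined by its values on functions (`isPoisson_of_commute`). Applied to `L - λ ∂_x`,
a deformation with leading function `q - λ`, this makes the pencil condition automatic. In the same
way two commuting flows with equal leading terms coincide (`field_eq_of_commute`), which yields both
the recursion between the two brackets and the uniqueness of `L`.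

For existence, the `H_f` commute under `∂_x` for arbitrary `c`, `p`, `s` (`commute_first_ham`).
Hence it suffices to find `L` with `L δH_g = ∂_x δH_f` whenever `f'' = q g'' + ½ q' g'`: then `{H_h,
H_g}_2 = {H_h, H_f}_1` is null. Explicit operators achieve this at order `ε²` without any condition.
At order `ε⁴` they achieve it up to a `defect` that is linear in `w = ½ p q' - c c' q'/384 + c²
q''/1920`. If `w = 0`, the structure exists. Conversely every structure satisfies the recursion, so
the defect is the value of a homogeneous operator on `g'`, and this forces `w = 0`
(`obstruction_eq_zero`).

Finally `w = 0` is the stated formula for `p`. Read as an equation for `q`, it is a linear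
first-order equation for `q'`; its nowhere vanishing solutions are proportional, so `q` is unique up
to `q ↦ a q + b`. -/

namespace BiHam

noncomputable section

variable {I : Opens ℝ}

/-! ### Calculus of smooth functions on an interval -/

namespace Smooth

theorem ext {f g : Smooth I} (h : ∀ u, f u = g u) : f = g := Subtype.ext (funext h)

@[simp] theorem add_apply (f g : Smooth I) (u : I) : (f + g) u = f u + g u := rfl
@[simp] theorem mul_apply (f g : Smooth I) (u : I) : (f * g) u = f u * g u := rfl
@[simp] theorem sub_apply (f g : Smooth I) (u : I) : (f - g) u = f u - g u := rfl
@[simp] theorem zero_apply (u : I) : (0 : Smooth I) u = 0 := rfl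
@[simp] theorem one_apply (u : I) : (1 : Smooth I) u = 1 := rfl
@[simp] theorem smul_apply (r : ℝ) (f : Smooth I) (u : I) : (r • f) u = r * f u := rfl
@[simp] theorem algebraMap_apply (r : ℝ) (u : I) : (algebraMap ℝ (Smooth I) r) u = r := rfl
@[simp] theorem pow_apply (f : Smooth I) (n : ℕ) (u : I) : (f ^ n) u = f u ^ n := rfl

/-- The restriction to `I` of a function that is smooth on `I`. -/
def mk (g : ℝ → ℝ) (hg : ContDiffOn ℝ ∞ g I) : Smooth I := ⟨fun u => g u, g, hg, fun _ => rfl⟩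

@[simp] theorem mk_apply (g : ℝ → ℝ) (hg : ContDiffOn ℝ ∞ g I) (u : I) : mk g hg u = g u := rfl

theorem exists_eq_mk (f : Smooth I) : ∃ g hg, f = mk g hg := by
  obtain ⟨f, g, hg, h⟩ := f
  exact ⟨g, hg, Smooth.ext h⟩

theorem der_apply {f : Smooth I} {g : ℝ → ℝ} (h : ∀ u : I, f u = g u) (u : I) :
    der f u = deriv g u := by
  apply Filter.EventuallyEq.deriv_eq
  filter_upwards [I.isOpen.mem_nhds u.2] with x hx
  exact (Subtype.val_injective.extend_apply (f : I → ℝ) 0 ⟨x, hx⟩).trans (h ⟨x, hx⟩)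

theorem hasDerivAt_of_contDiffOn {g : ℝ → ℝ} (hg : ContDiffOn ℝ ∞ g I) (u : I) :
    HasDerivAt g (deriv g u) u :=
  ((hg.differentiableOn (by simp)).differentiableAt (I.isOpen.mem_nhds u.2)).hasDerivAt

theorem der_mk_apply {g : ℝ → ℝ} (hg : ContDiffOn ℝ ∞ g I) (u : I) :
    der (mk g hg) u = deriv g u := der_apply (fun _ => rfl) u

theorem der_add (f g : Smooth I) : der (f + g) = der f + der g := by
  obtain ⟨a, ha, rfl⟩ := exists_eq_mk f
  obtain ⟨b, hb, rfl⟩ := exists_eq_mk g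
  refine Smooth.ext fun u => ?_
  rw [add_apply, der_mk_apply, der_mk_apply, der_apply (g := a + b) fun _ => rfl]
  exact ((hasDerivAt_of_contDiffOn ha u).add (hasDerivAt_of_contDiffOn hb u)).deriv

theorem der_mul (f g : Smooth I) : der (f * g) = f * der g + g * der f := by
  obtain ⟨a, ha, rfl⟩ := exists_eq_mk f
  obtain ⟨b, hb, rfl⟩ := exists_eq_mk g
  refine Smooth.ext fun u => ?_
  rw [add_apply, mul_apply, mul_apply, der_mk_apply, der_mk_apply,
    der_apply (g := a * b) fun _ => rfl]
  rw [((hasDerivAt_of_contDiffOn ha u).mul (hasDerivAt_of_contDiffOn hb u)).deriv]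
  simp only [mk_apply]; ring

theorem der_smul (r : ℝ) (f : Smooth I) : der (r • f) = r • der f := by
  obtain ⟨a, ha, rfl⟩ := exists_eq_mk f
  refine Smooth.ext fun u => ?_
  rw [smul_apply, der_mk_apply, der_apply (g := fun x => r * a x) fun _ => rfl]
  exact ((hasDerivAt_of_contDiffOn ha u).const_mul r).deriv

end Smooth

/-- `f ↦ f'` as a derivation of `C^∞(I)`. -/
def derD : Derivation ℝ (Smooth I) (Smooth I) :=
  Derivation.mk' ⟨⟨der, Smooth.der_add⟩, Smooth.der_smul⟩ fun f g => Smooth.der_mul f g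

@[simp] theorem derD_apply (f : Smooth I) : derD f = der f := rfl

namespace Smooth

@[simp] theorem der_zero : der (0 : Smooth I) = 0 := map_zero derD
@[simp] theorem der_one : der (1 : Smooth I) = 0 := Derivation.map_one_eq_zero derD
theorem der_sub (f g : Smooth I) : der (f - g) = der f - der g := map_sub derD f g
theorem der_algebraMap (r : ℝ) : der (algebraMap ℝ (Smooth I) r) = 0 := derD.map_algebraMap r

theorem exists_der_eq (hI : IsConnected (I : Set ℝ)) (f : Smooth I) :
    ∃ g : Smooth I, der g = f := by
  obtain ⟨a, ha, rfl⟩ := exists_eq_mk f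
  obtain ⟨u₀, hu₀⟩ := hI.nonempty
  -- Connectedness is needed so that the segment from the base point to `u` stays in `I`.
  have hord := hI.isPreconnected.ordConnected
  have hd : ∀ u ∈ (I : Set ℝ), HasDerivAt (fun v => ∫ t in u₀..v, a t) (a u) u := by
    intro u hu
    have hc : ContinuousOn a (Set.uIcc u₀ u) := ha.continuousOn.mono (hord.uIcc_subset hu₀ hu)
    refine intervalIntegral.integral_hasDerivAt_right hc.intervalIntegrable ?_
      (ha.continuousOn.continuousAt (I.isOpen.mem_nhds hu))
    exact ha.continuousOn.stronglyMeasurableAtFilter I.isOpen u hu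
  have hG : ContDiffOn ℝ ∞ (fun v => ∫ t in u₀..v, a t) I := by
    refine (contDiffOn_infty_iff_deriv_of_isOpen I.isOpen).2
      ⟨fun u hu => (hd u hu).differentiableAt.differentiableWithinAt, ?_⟩
    exact ha.congr fun u hu => (hd u hu).deriv
  exact ⟨mk _ hG, Smooth.ext fun u => by rw [der_mk_apply, (hd u u.2).deriv, mk_apply]⟩

theorem exists_eq_of_der_eq_zero (hI : IsConnected (I : Set ℝ)) {f : Smooth I} (h : der f = 0) :
    ∃ r : ℝ, f = algebraMap ℝ _ r := by
  obtain ⟨a, ha, rfl⟩ := exists_eq_mk f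
  obtain ⟨r, hr⟩ := I.isOpen.exists_is_const_of_deriv_eq_zero hI.isPreconnected
    (ha.differentiableOn (by simp)) (fun u hu => by
      rw [← der_mk_apply ha ⟨u, hu⟩, h]; rfl)
  exact ⟨r, Smooth.ext fun u => hr u.1 u.2⟩

/-- The inverse of a nowhere vanishing function. -/
theorem exists_mul_eq_one {f : Smooth I} (h : ∀ u, f u ≠ 0) : ∃ g : Smooth I, f * g = 1 := by
  obtain ⟨a, ha, rfl⟩ := exists_eq_mk f
  exact ⟨mk _ (ha.inv fun u hu => h ⟨u, hu⟩), Smooth.ext fun u => mul_inv_cancel₀ (h u)⟩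

/-- The exponential of a function. -/
theorem exists_exp (f : Smooth I) : ∃ g : Smooth I, (∀ u, g u ≠ 0) ∧ der g = der f * g := by
  obtain ⟨a, ha, rfl⟩ := exists_eq_mk f
  refine ⟨mk _ ha.exp, fun u => (Real.exp_pos _).ne', Smooth.ext fun u => ?_⟩
  rw [mul_apply, der_mk_apply, der_mk_apply, (hasDerivAt_of_contDiffOn ha u).exp.deriv, mul_comm]
  rfl

/-- The function `(u - a)^k / k!`. -/
def divPow (a : ℝ) (k : ℕ) : Smooth I :=
  mk (fun u => (u - a) ^ k / (k.factorial : ℝ)) (by fun_prop)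

theorem der_divPow_succ (a : ℝ) (k : ℕ) : der (divPow a (k + 1) : Smooth I) = divPow a k := by
  refine Smooth.ext fun u => ?_
  rw [divPow, der_mk_apply]
  have h : HasDerivAt (fun u : ℝ => (u - a) ^ (k + 1) / ((k + 1).factorial : ℝ))
      (((k + 1 : ℕ) : ℝ) * (u - a) ^ k * 1 / ((k + 1).factorial : ℝ)) u := by
    simpa using (((hasDerivAt_id (u : ℝ)).sub_const a).pow (k + 1)).div_const _
  rw [h.deriv, divPow, mk_apply, Nat.factorial_succ]
  push_cast
  field_simp

theorem divPow_apply_zero (u : I) : (divPow u.1 0 : Smooth I) u = 1 := by simp [divPow]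

theorem divPow_apply_succ (u : I) (k : ℕ) : (divPow u.1 (k + 1) : Smooth I) u = 0 := by
  simp [divPow]

/-- Evaluation at a point. -/
def evalHom (u : I) : Smooth I →ₐ[ℝ] ℝ where
  toFun f := f u
  map_one' := rfl
  map_mul' _ _ := rfl
  map_zero' := rfl
  map_add' _ _ := rfl
  commutes' _ := rfl

@[simp] theorem evalHom_apply (u : I) (f : Smooth I) : evalHom u f = f u := rfl

end Smooth

/-! ### Total and variational derivatives on the jet algebra -/

theorem coeff_partialU (F : DiffPoly I) (m : ℕ →₀ ℕ) :
    (partialU F).coeff m = der (F.coeff m) := by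
  rw [partialU, MvPolynomial.coeff_sum]
  simp only [MvPolynomial.coeff_monomial]
  rw [Finset.sum_ite_eq']
  split_ifs with h
  · rfl
  · rw [MvPolynomial.notMem_support_iff.1 h, Smooth.der_zero]

/-- `∂/∂u` as a derivation. -/
def partialUD : Derivation ℝ (DiffPoly I) (DiffPoly I) :=
  Derivation.mk' ⟨⟨partialU, fun F G => by
      ext1 m; simp [coeff_partialU, Smooth.der_add]⟩, fun r F => by
      ext1 m
      simp [coeff_partialU, Smooth.der_smul]⟩ fun F G => by
    ext1 m
    simp only [LinearMap.coe_mk, AddHom.coe_mk, smul_eq_mul, mul_comm G, MvPolynomial.coeff_add,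
      coeff_partialU, MvPolynomial.coeff_mul]
    rw [← derD_apply, map_sum, ← Finset.sum_add_distrib]
    refine Finset.sum_congr rfl fun x _ => ?_
    rw [derD_apply, Smooth.der_mul, mul_comm (der _)]

@[simp] theorem partialUD_apply (F : DiffPoly I) : partialUD F = partialU F := rfl

@[simp] theorem partialU_fn (f : Smooth I) : partialU (fn f) = fn (der f) := by
  classical
  ext1 m
  rw [coeff_partialU, fn, fn, MvPolynomial.coeff_C, MvPolynomial.coeff_C]
  split_ifs <;> simp

@[simp] theorem partialU_jet (n : ℕ) : partialU (jet n : DiffPoly I) = 0 := by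
  classical
  ext1 m
  rw [coeff_partialU, jet, MvPolynomial.coeff_X, MvPolynomial.coeff_zero]
  split_ifs <;> simp

theorem derivation_sum_apply (s : Finset ℕ)
    (d : ℕ → Derivation (Smooth I) (DiffPoly I) (DiffPoly I)) (F : DiffPoly I) :
    (∑ n ∈ s, d n) F = ∑ n ∈ s, d n F := by
  induction s using Finset.cons_induction with
  | empty => simp
  | cons a s h ih => rw [Finset.sum_cons, Finset.sum_cons, Derivation.add_apply, ih]

/-- The derivation with `fn f ↦ a * fn f'` and `u^{(n+1)} ↦ b n`. -/
def vectorField (a : DiffPoly I) (b : ℕ → DiffPoly I) : Derivation ℝ (DiffPoly I) (DiffPoly I) :=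
  a • partialUD + (MvPolynomial.mkDerivation (Smooth I) b).restrictScalars ℝ

theorem vectorField_apply {a : DiffPoly I} {b : ℕ → DiffPoly I} {F : DiffPoly I} {s : Finset ℕ}
    (hs : F.vars ⊆ s) :
    vectorField a b F = a * partialU F + ∑ n ∈ s, b n * MvPolynomial.pderiv n F := by
  have h : MvPolynomial.mkDerivation (Smooth I) b F
      = (∑ n ∈ s, b n • MvPolynomial.pderiv n :
        Derivation (Smooth I) (DiffPoly I) (DiffPoly I)) F := by
    refine MvPolynomial.derivation_eq_of_forall_mem_vars fun i hi => ?_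
    rw [MvPolynomial.mkDerivation_X, derivation_sum_apply,
      Finset.sum_eq_single_of_mem i (hs hi)]
    · simp
    · intro n _ hn
      simp [MvPolynomial.pderiv_X_of_ne hn.symm]
  simp [vectorField, h, derivation_sum_apply]

@[simp] theorem vectorField_fn (a : DiffPoly I) (b : ℕ → DiffPoly I) (f : Smooth I) :
    vectorField a b (fn f) = a * fn (der f) := by
  rw [vectorField_apply (s := ∅) (by simp [fn])]; simp

@[simp] theorem vectorField_jet (a : DiffPoly I) (b : ℕ → DiffPoly I) (n : ℕ) :
    vectorField a b (jet n) = b n := by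
  rw [vectorField, Derivation.add_apply, Derivation.smul_apply, partialUD_apply, partialU_jet]
  simp [jet]

/-- Functions of `u` and jet variables generate the algebra. The commutator identities for `∂_x`,
the partial derivatives and evolutionary fields are all checked on these generators. -/
theorem derivation_ext {d e : Derivation ℝ (DiffPoly I) (DiffPoly I)}
    (hf : ∀ f, d (fn f) = e (fn f)) (hj : ∀ n, d (jet n) = e (jet n)) : d = e := by
  ext1 F
  induction F using MvPolynomial.induction_on with
  | C f => exact hf f
  | add F G hF hG => rw [map_add, map_add, hF, hG]
  | mul_X F n h =>
    have := hj n
    rw [jet] at this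
    rw [d.leibniz, e.leibniz, h, this]

/-- The total derivative as a derivation. -/
def dxD : Derivation ℝ (DiffPoly I) (DiffPoly I) := vectorField (jet 0) fun n => jet (n + 1)

/-- The total derivative as a linear map. -/
def dx : Module.End ℝ (DiffPoly I) := dxD.toLinearMap

theorem totalD_eq (F : DiffPoly I) : totalD F = dx F := (vectorField_apply subset_rfl).symm

theorem iterate_totalD (k : ℕ) (F : DiffPoly I) : totalD^[k] F = (dx ^ k) F := by
  rw [Module.End.pow_apply]
  exact congrArg (fun t : DiffPoly I → DiffPoly I => t^[k] F) (funext totalD_eq)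

@[simp] theorem dxD_apply (F : DiffPoly I) : dxD F = dx F := rfl

@[simp] theorem dx_fn (f : Smooth I) : dx (fn f) = fn (der f) * jet 0 := by
  rw [← dxD_apply, dxD, vectorField_fn, mul_comm]

@[simp] theorem dx_jet (n : ℕ) : dx (jet n : DiffPoly I) = jet (n + 1) := by
  rw [← dxD_apply, dxD, vectorField_jet]

theorem dx_mul (F G : DiffPoly I) : dx (F * G) = F * dx G + G * dx F := dxD.leibniz F G

theorem dx_pow_succ (k : ℕ) (F : DiffPoly I) : (dx ^ (k + 1)) F = dx ((dx ^ k) F) := by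
  rw [pow_succ']; rfl

theorem neg_dx_pow_succ (k : ℕ) (F : DiffPoly I) :
    ((-dx) ^ (k + 1)) F = -dx (((-dx) ^ k) F) := by
  rw [pow_succ']; rfl

theorem neg_dx_pow (k : ℕ) (F : DiffPoly I) : ((-dx) ^ k) F = (-1) ^ k * (dx ^ k) F := by
  induction k with
  | zero => simp
  | succ k ih =>
    have h : dx ((-1 : DiffPoly I) ^ k) = 0 := by
      rw [← dxD_apply, dxD.leibniz_pow, map_neg, Derivation.map_one_eq_zero]; simp
    rw [neg_dx_pow_succ, ih, dx_mul, h, dx_pow_succ, pow_succ]; ring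

theorem varD_eq {F : DiffPoly I} {s : Finset ℕ} (hs : F.vars ⊆ s) :
    varD F = partialU F + ∑ n ∈ s, ((-dx) ^ (n + 1)) (MvPolynomial.pderiv n F) := by
  rw [varD]
  congr 1
  simp only [iterate_totalD, ← neg_dx_pow]
  refine Finset.sum_subset hs fun n _ hn => ?_
  rw [MvPolynomial.pderiv_eq_zero_of_notMem_vars hn, map_zero]

theorem vars_subset_range (F : DiffPoly I) : ∃ N, ∀ M, N ≤ M → F.vars ⊆ Finset.range M := by
  obtain ⟨N, hN⟩ := F.vars.exists_nat_subset_range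
  exact ⟨N, fun M h => hN.trans (Finset.range_mono h)⟩

theorem varD_add (F G : DiffPoly I) : varD (F + G) = varD F + varD G := by
  classical
  have h : (F + G).vars ⊆ F.vars ∪ G.vars := MvPolynomial.vars_add_subset F G
  rw [varD_eq h, varD_eq (F := F) Finset.subset_union_left,
    varD_eq (F := G) Finset.subset_union_right, ← partialUD_apply]
  simp only [map_add, Finset.sum_add_distrib, partialUD_apply]
  ring

theorem partialU_dx (F : DiffPoly I) : partialU (dx F) = dx (partialU F) := by
  have h : ⁅(partialUD : Derivation ℝ (DiffPoly I) (DiffPoly I)),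
      (dxD : Derivation ℝ (DiffPoly I) (DiffPoly I))⁆ = 0 := by
    refine derivation_ext (fun f => ?_) fun n => ?_
    · simp only [Derivation.commutator_apply, dxD_apply, partialUD_apply, dx_fn, partialU_fn,
        Derivation.zero_apply]
      rw [← partialUD_apply, Derivation.leibniz]; simp [mul_comm]
    · simp [Derivation.commutator_apply]
  have := congrArg (fun d => d F) h
  simpa [Derivation.commutator_apply, sub_eq_zero] using this

/-- `∂/∂u^{(n+1)}` as a derivation over `ℝ`. -/
def pderivD (n : ℕ) : Derivation ℝ (DiffPoly I) (DiffPoly I) :=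
  (MvPolynomial.pderiv n).restrictScalars ℝ

@[simp] theorem pderivD_apply (n : ℕ) (F : DiffPoly I) :
    pderivD n F = MvPolynomial.pderiv n F := rfl

@[simp] theorem pderiv_fn (n : ℕ) (f : Smooth I) : MvPolynomial.pderiv n (fn f) = 0 :=
  MvPolynomial.pderiv_C

theorem pderiv_jet (n m : ℕ) :
    MvPolynomial.pderiv n (jet m : DiffPoly I) = if m = n then 1 else 0 := by
  rw [jet, MvPolynomial.pderiv_X, Pi.single_apply]

/-- The variable below `X 0 = u_x` is `u` itself, so the commutator of `∂/∂u_x` with `∂_x` is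
`∂/∂u`, and this case is separate from `pderiv_succ_dx`. -/
theorem pderiv_zero_dx (F : DiffPoly I) :
    MvPolynomial.pderiv 0 (dx F) = dx (MvPolynomial.pderiv 0 F) + partialU F := by
  have h : ⁅(pderivD 0 : Derivation ℝ (DiffPoly I) (DiffPoly I)),
      (dxD : Derivation ℝ (DiffPoly I) (DiffPoly I))⁆ = partialUD := by
    refine derivation_ext (fun f => ?_) fun n => ?_
    · simp [Derivation.commutator_apply, pderiv_jet]
    · simp only [Derivation.commutator_apply, dxD_apply, dx_jet, pderivD_apply, pderiv_jet,
        partialUD_apply, partialU_jet]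
      split_ifs <;> simp_all [← dxD_apply]
  have := congrArg (fun d => d F) h
  simpa [Derivation.commutator_apply, sub_eq_iff_eq_add, add_comm] using this

theorem pderiv_succ_dx (k : ℕ) (F : DiffPoly I) : MvPolynomial.pderiv (k + 1) (dx F) =
    dx (MvPolynomial.pderiv (k + 1) F) + MvPolynomial.pderiv k F := by
  have h : ⁅(pderivD (k + 1) : Derivation ℝ (DiffPoly I) (DiffPoly I)),
      (dxD : Derivation ℝ (DiffPoly I) (DiffPoly I))⁆ = pderivD k := by
    refine derivation_ext (fun f => ?_) fun n => ?_
    · simp [Derivation.commutator_apply, pderiv_jet]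
    · simp only [Derivation.commutator_apply, dxD_apply, dx_jet, pderivD_apply, pderiv_jet]
      split_ifs <;> simp_all [← dxD_apply]
  have := congrArg (fun d => d F) h
  simpa [Derivation.commutator_apply, sub_eq_iff_eq_add, add_comm] using this

theorem varD_dx (F : DiffPoly I) : varD (dx F) = 0 := by
  obtain ⟨N, hN⟩ := vars_subset_range F
  obtain ⟨M, hM⟩ := vars_subset_range (dx F)
  -- The Euler operator applied to a total derivative telescopes: a partial sum leaves one boundary
  -- term, which is zero once `K` exceeds the order of `F`.
  have key : ∀ K, partialU (dx F) + ∑ n ∈ Finset.range (K + 1),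
      ((-dx) ^ (n + 1)) (MvPolynomial.pderiv n (dx F))
        = -((-dx) ^ (K + 2)) (MvPolynomial.pderiv K F) := by
    intro K
    induction K with
    | zero =>
      rw [Finset.sum_range_one, pderiv_zero_dx, partialU_dx]
      simp [neg_dx_pow_succ]
    | succ K ih =>
      rw [Finset.sum_range_succ, ← add_assoc, ih, pderiv_succ_dx, map_add]
      have : ((-dx) ^ (K + 1 + 1)) (dx (MvPolynomial.pderiv (K + 1) F)) =
          -((-dx) ^ (K + 1 + 2)) (MvPolynomial.pderiv (K + 1) F) := by
        rw [pow_succ _ (K + 2)]; simp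
      rw [this]; abel
  have h0 : MvPolynomial.pderiv (max N M) F = 0 :=
    MvPolynomial.pderiv_eq_zero_of_notMem_vars fun h => by
      have := hN _ (le_max_left N M) h
      simp at this
  rw [varD_eq (hM (max N M + 1) (by omega)), key, h0, map_zero, neg_zero]

/-! ### Local functionals and evolutionary vector fields -/

/-- Local functionals: densities modulo total derivatives. -/
def loc : DiffPoly I →ₗ[ℝ] DiffPoly I ⧸ LinearMap.range (dx : Module.End ℝ (DiffPoly I)) :=
  Submodule.mkQ _

theorem loc_eq_zero {F : DiffPoly I} : loc F = 0 ↔ ∃ Q, F = totalD Q := by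
  rw [loc, Submodule.mkQ_apply, Submodule.Quotient.mk_eq_zero, LinearMap.mem_range]
  simp only [totalD_eq, eq_comm]

theorem varD_eq_zero_of_loc {F : DiffPoly I} (h : loc F = 0) : varD F = 0 := by
  obtain ⟨Q, rfl⟩ := loc_eq_zero.1 h
  rw [totalD_eq, varD_dx]

theorem loc_dx (F : DiffPoly I) : loc (dx F) = 0 := loc_eq_zero.2 ⟨F, (totalD_eq F).symm⟩

theorem loc_mul_dx (a b : DiffPoly I) : loc (a * dx b) = -loc (dx a * b) := by
  have := loc_dx (a * b)
  rw [dx_mul, map_add, mul_comm b] at this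
  exact eq_neg_of_add_eq_zero_left this

theorem loc_mul_dx_pow (k : ℕ) (a b : DiffPoly I) :
    loc (a * (dx ^ k) b) = loc (((-dx) ^ k) a * b) := by
  induction k generalizing a with
  | zero => simp
  | succ k ih =>
    rw [dx_pow_succ, loc_mul_dx, ← map_neg, ← neg_mul, ih, pow_succ]
    rfl

/-- The evolutionary vector field with characteristic `X`. -/
def pr (X : DiffPoly I) : Derivation ℝ (DiffPoly I) (DiffPoly I) :=
  vectorField X fun n => (dx ^ (n + 1)) X

@[simp] theorem pr_fn (X : DiffPoly I) (f : Smooth I) : pr X (fn f) = X * fn (der f) :=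
  vectorField_fn _ _ _

@[simp] theorem pr_jet (X : DiffPoly I) (n : ℕ) : pr X (jet n) = (dx ^ (n + 1)) X :=
  vectorField_jet _ _ _

theorem pr_apply {X F : DiffPoly I} {s : Finset ℕ} (hs : F.vars ⊆ s) :
    pr X F = X * partialU F + ∑ n ∈ s, (dx ^ (n + 1)) X * MvPolynomial.pderiv n F :=
  vectorField_apply hs

/-- First variation formula: integrating by parts moves every `∂_x` in the prolongation from `X` to
the partial derivatives of `F`. -/
theorem loc_varD_mul (F X : DiffPoly I) : loc (varD F * X) = loc (pr X F) := by
  rw [pr_apply subset_rfl, varD_eq subset_rfl, add_mul, map_add, map_add, Finset.sum_mul, map_sum,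
    map_sum, mul_comm X]
  congr 1
  refine Finset.sum_congr rfl fun n _ => ?_
  rw [← loc_mul_dx_pow, mul_comm]

theorem pr_dx (X F : DiffPoly I) : pr X (dx F) = dx (pr X F) := by
  have h : ⁅pr X, (dxD : Derivation ℝ (DiffPoly I) (DiffPoly I))⁆ = 0 := by
    refine derivation_ext (fun f => ?_) fun n => ?_
    · simp only [Derivation.commutator_apply, dxD_apply, pr_fn, dx_fn, Derivation.leibniz,
        pr_jet, Derivation.zero_apply, smul_eq_mul, zero_add, pow_one]
      ring
    · simp [Derivation.commutator_apply, dx_pow_succ]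
  have := congrArg (fun d => d F) h
  simpa [Derivation.commutator_apply, sub_eq_zero] using this

theorem pr_dx_pow (k : ℕ) (X F : DiffPoly I) : pr X ((dx ^ k) F) = (dx ^ k) (pr X F) := by
  induction k with
  | zero => simp
  | succ k ih => rw [dx_pow_succ, pr_dx, ih, dx_pow_succ]

/-- Evolutionary fields commute with `∂_x`, so their commutator is again evolutionary and is
determined by its characteristic. -/
theorem pr_pr (X Y F : DiffPoly I) :
    pr X (pr Y F) - pr Y (pr X F) = pr (pr X Y - pr Y X) F := by
  have h : ⁅pr X, pr Y⁆ = pr (pr X Y - pr Y X) := by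
    refine derivation_ext (fun f => ?_) fun n => ?_
    · simp only [Derivation.commutator_apply, pr_fn, Derivation.leibniz, smul_eq_mul]
      ring
    · simp [Derivation.commutator_apply, pr_dx_pow]
  exact congrArg (fun d => d F) h

/-- The linearization of a variational derivative is self-adjoint. -/
theorem loc_pr_varD_mul (F X Y : DiffPoly I) :
    loc (pr X (varD F) * Y) = loc (pr Y (varD F) * X) := by
  have h (X Y : DiffPoly I) : loc (pr X (varD F) * Y) =
      loc (pr X (pr Y F)) - loc (varD F * pr X Y) := by
    -- `pr X` commutes with `∂_x`, hence acts on local functionals.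
    have h1 : ∀ G H : DiffPoly I, loc G = loc H → loc (pr X G) = loc (pr X H) := by
      intro G H e
      rw [← sub_eq_zero, ← map_sub] at e
      obtain ⟨Q, hQ⟩ := loc_eq_zero.1 e
      rw [← sub_eq_zero, ← map_sub, ← map_sub, hQ, totalD_eq, pr_dx, loc_dx]
    rw [← h1 _ _ (loc_varD_mul F Y), Derivation.leibniz, map_add, smul_eq_mul, smul_eq_mul,
      mul_comm Y]
    abel
  -- The asymmetry of the second variation, `pr X (pr Y F) - pr Y (pr X F)`, is the first variation
  -- along the commutator, which cancels the remaining terms.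
  rw [h X Y, h Y X, sub_eq_sub_iff_sub_eq_sub, ← map_sub, ← map_sub, pr_pr, ← mul_sub,
    loc_varD_mul]

/-! ### The degree filtration -/

/-- The differential polynomials all of whose monomials have degree at least `d`. -/
def degGE (d : ℕ) : Ideal (DiffPoly I) where
  carrier := {F | ∀ m, F.coeff m ≠ 0 → d ≤ Finsupp.weight (fun n : ℕ => n + 1) m}
  zero_mem' := by simp
  add_mem' := by
    intro F G hF hG m hm
    rw [MvPolynomial.coeff_add] at hm
    by_cases h : F.coeff m = 0
    · exact hG m (by simpa [h] using hm)
    · exact hF m h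
  smul_mem' := by
    classical
    intro F G hG m hm
    rw [smul_eq_mul, MvPolynomial.coeff_mul] at hm
    obtain ⟨x, hx, hne⟩ := Finset.exists_ne_zero_of_sum_ne_zero hm
    rw [← Finset.HasAntidiagonal.mem_antidiagonal.1 hx, map_add]
    exact (hG _ (right_ne_zero_of_mul hne)).trans (Nat.le_add_left _ _)

theorem degGE_anti {d e : ℕ} (h : d ≤ e) {F : DiffPoly I} (hF : F ∈ degGE e) : F ∈ degGE d :=
  fun m hm => h.trans (hF m hm)

theorem mem_degGE_zero (F : DiffPoly I) : F ∈ degGE 0 := fun _ _ => Nat.zero_le _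

theorem HasDegree.mem_degGE {F : DiffPoly I} {d : ℕ} (h : HasDegree F d) : F ∈ degGE d :=
  fun _ hm => (h hm).ge

theorem mul_mem_degGE {d e k : ℕ} (hk : k ≤ d + e) {F G : DiffPoly I} (hF : F ∈ degGE d)
    (hG : G ∈ degGE e) : F * G ∈ degGE k := by
  classical
  intro m hm
  rw [MvPolynomial.coeff_mul] at hm
  obtain ⟨x, hx, hne⟩ := Finset.exists_ne_zero_of_sum_ne_zero hm
  rw [← Finset.HasAntidiagonal.mem_antidiagonal.1 hx, map_add]
  exact hk.trans (add_le_add (hF _ (left_ne_zero_of_mul hne)) (hG _ (right_ne_zero_of_mul hne)))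

theorem hasDegree_fn (f : Smooth I) : HasDegree (fn f) 0 :=
  MvPolynomial.isWeightedHomogeneous_C _ _

theorem hasDegree_jet (n : ℕ) : HasDegree (jet n : DiffPoly I) (n + 1) :=
  MvPolynomial.isWeightedHomogeneous_X _ _ _

theorem partialU_mem_degGE {d : ℕ} {F : DiffPoly I} (hF : F ∈ degGE d) : partialU F ∈ degGE d := by
  intro m hm
  refine hF m fun h => hm ?_
  rw [coeff_partialU, h, Smooth.der_zero]

theorem pderiv_mem_degGE {d : ℕ} {F : DiffPoly I} (hF : F ∈ degGE d) (n : ℕ) :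
    MvPolynomial.pderiv n F ∈ degGE (d - (n + 1)) := by
  intro m hm
  rw [MvPolynomial.coeff_pderiv] at hm
  have := hF _ (left_ne_zero_of_mul hm)
  rw [map_add, Finsupp.weight_single] at this
  simp at this
  omega

theorem vectorField_mem_degGE {d e k : ℕ} (hk : k ≤ d + e) {a : DiffPoly I} {b : ℕ → DiffPoly I}
    (ha : a ∈ degGE e) (hb : ∀ n, b n ∈ degGE (e + (n + 1))) {F : DiffPoly I} (hF : F ∈ degGE d) :
    vectorField a b F ∈ degGE k := by
  rw [vectorField_apply subset_rfl]
  refine add_mem (mul_mem_degGE (by omega) ha (partialU_mem_degGE hF)) (sum_mem fun n _ => ?_)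
  exact mul_mem_degGE (by omega) (hb n) (pderiv_mem_degGE hF n)

theorem dx_mem_degGE {d : ℕ} {F : DiffPoly I} (hF : F ∈ degGE d) : dx F ∈ degGE (d + 1) :=
  vectorField_mem_degGE le_rfl (hasDegree_jet 0).mem_degGE
    (fun n => degGE_anti (by omega) (hasDegree_jet (n + 1)).mem_degGE) hF

theorem dx_pow_mem_degGE {d : ℕ} {F : DiffPoly I} (hF : F ∈ degGE d) (k : ℕ) :
    (dx ^ k) F ∈ degGE (d + k) := by
  induction k with
  | zero => exact hF
  | succ k ih => rw [dx_pow_succ]; exact dx_mem_degGE ih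

theorem neg_dx_pow_mem_degGE {d : ℕ} {F : DiffPoly I} (hF : F ∈ degGE d) (k : ℕ) :
    ((-dx) ^ k) F ∈ degGE (d + k) := by
  rw [neg_dx_pow]; exact Ideal.mul_mem_left _ _ (dx_pow_mem_degGE hF k)

theorem pr_mem_degGE {d e k : ℕ} (hk : k ≤ d + e) {X F : DiffPoly I} (hX : X ∈ degGE e)
    (hF : F ∈ degGE d) : pr X F ∈ degGE k :=
  vectorField_mem_degGE hk hX (fun n => dx_pow_mem_degGE hX (n + 1)) hF

/-! ### Testing with powers of `u - a` -/

/-- Evaluation of the coefficients at a point of `I`. -/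
def atPoint (u : I) : DiffPoly I →+* MvPolynomial ℕ ℝ :=
  MvPolynomial.map (Smooth.evalHom u).toRingHom

theorem coeff_atPoint (u : I) (F : DiffPoly I) (m : ℕ →₀ ℕ) :
    (atPoint u F).coeff m = F.coeff m u := MvPolynomial.coeff_map _ _ _

theorem atPoint_fn (u : I) (f : Smooth I) : atPoint u (fn f) = MvPolynomial.C (f u) :=
  MvPolynomial.map_C _ _

theorem atPoint_jet (u : I) (n : ℕ) : atPoint u (jet n) = MvPolynomial.X n :=
  MvPolynomial.map_X _ _

theorem ext_atPoint {F G : DiffPoly I} (h : ∀ u, atPoint u F = atPoint u G) : F = G := by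
  ext1 m
  refine Smooth.ext fun u => ?_
  rw [← coeff_atPoint, h, coeff_atPoint]

theorem eq_zero_of_atPoint {F : DiffPoly I} (h : ∀ u, atPoint u F = 0) : F = 0 :=
  ext_atPoint fun u => by rw [h, map_zero]

/-- Each derivative falling on the divided power lowers its exponent by at most one. With fewer than
`k` derivatives a positive power of `u - a` remains and vanishes at `a`. -/
theorem atPoint_neg_dx_pow_divPow_of_lt (u : I) {j k : ℕ} (h : j < k) (Z : DiffPoly I) :
    atPoint u (((-dx) ^ j) (fn (Smooth.divPow u k) * Z)) = 0 := by
  induction j generalizing k Z with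
  | zero =>
    obtain ⟨k, rfl⟩ := Nat.exists_eq_succ_of_ne_zero h.ne'
    rw [pow_zero, Module.End.one_apply, map_mul, atPoint_fn, Smooth.divPow_apply_succ]
    simp
  | succ j ih =>
    obtain ⟨k, rfl⟩ := Nat.exists_eq_succ_of_ne_zero (show k ≠ 0 by omega)
    have : ((-dx) ^ (j + 1)) (fn (Smooth.divPow u (k + 1)) * Z) =
        -(((-dx) ^ j) (fn (Smooth.divPow u (k + 1)) * dx Z) +
          ((-dx) ^ j) (fn (Smooth.divPow u k) * (jet 0 * Z))) := by
      rw [pow_succ, Module.End.mul_apply, LinearMap.neg_apply, map_neg, dx_mul, dx_fn,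
        Smooth.der_divPow_succ, map_add]
      congr 3; ring_nf
    rw [this, map_neg, map_add, ih (by omega), ih (by omega), add_zero, neg_zero]

/-- With exactly `k` derivatives only the term in which all of them hit the divided power survives
at the point; each contributes a factor `-u_x`. -/
theorem atPoint_neg_dx_pow_divPow (u : I) (k : ℕ) (Z : DiffPoly I) :
    atPoint u (((-dx) ^ k) (fn (Smooth.divPow u k) * Z)) =
      (-MvPolynomial.X 0) ^ k * atPoint u Z := by
  induction k generalizing Z with
  | zero =>
    rw [pow_zero, Module.End.one_apply, map_mul, atPoint_fn, Smooth.divPow_apply_zero]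
    simp
  | succ k ih =>
    have : ((-dx) ^ (k + 1)) (fn (Smooth.divPow u (k + 1)) * Z) =
        -(((-dx) ^ k) (fn (Smooth.divPow u (k + 1)) * dx Z) +
          ((-dx) ^ k) (fn (Smooth.divPow u k) * (jet 0 * Z))) := by
      rw [pow_succ, Module.End.mul_apply, LinearMap.neg_apply, map_neg, dx_mul, dx_fn,
        Smooth.der_divPow_succ, map_add]
      congr 3; ring_nf
    rw [this, map_neg, map_add, atPoint_neg_dx_pow_divPow_of_lt u k.lt_succ_self, ih, map_mul,
      atPoint_jet]
    ring

/-- A monomial containing the variable has its coefficient multiplied by a positive integer.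
Cancellation is done pointwise, where the values are real numbers. -/
theorem notMem_vars_of_pderiv_eq_zero {F : DiffPoly I} {n : ℕ}
    (h : MvPolynomial.pderiv n F = 0) : n ∉ F.vars := by
  intro hn
  obtain ⟨m, hm, hnm⟩ := (MvPolynomial.mem_vars_iff_mem_support n).1 hn
  have hc := congrArg (MvPolynomial.coeff (m - Finsupp.single n 1)) h
  have hm' : m - Finsupp.single n 1 + Finsupp.single n 1 = m :=
    tsub_add_cancel_of_le (Finsupp.single_le_iff.2
      (Nat.one_le_iff_ne_zero.2 (Finsupp.mem_support_iff.1 hnm)))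
  rw [MvPolynomial.coeff_pderiv, hm', MvPolynomial.coeff_zero] at hc
  refine MvPolynomial.mem_support_iff.1 hm (Smooth.ext fun u => ?_)
  have hu := congrArg (fun f => Smooth.evalHom u f) hc
  simp only [map_mul, map_add, map_natCast, map_one, map_zero] at hu
  exact (mul_eq_zero.1 hu).resolve_right (by positivity)

/-- A density of degree at least two that is null after multiplication with any function
of `u` vanishes. -/
theorem eq_zero_of_loc_fn_mul {Y : DiffPoly I} (hY : Y ∈ degGE 2)
    (h : ∀ f : Smooth I, loc (fn f * Y) = 0) : Y = 0 := by
  have hv : ∀ (f : Smooth I) (N : ℕ), Y.vars ⊆ Finset.range N →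
      fn (der f) * Y + fn f * partialU Y +
        ∑ n ∈ Finset.range N, ((-dx) ^ (n + 1)) (fn f * MvPolynomial.pderiv n Y) = 0 := by
    intro f N hN
    have hN' : (fn f * Y).vars ⊆ Finset.range N := by
      classical
      refine (MvPolynomial.vars_mul _ _).trans ?_
      rw [fn, MvPolynomial.vars_C, Finset.empty_union]; exact hN
    have := varD_eq_zero_of_loc (h f)
    rw [varD_eq hN', ← partialUD_apply, Derivation.leibniz] at this
    rw [← this]
    simp only [partialUD_apply, smul_eq_mul, partialU_fn, Derivation.leibniz, pderiv_fn, mul_zero,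
      add_zero]
    ring
  -- The top variable `X (n + 1) = u^{(n+2)}` enters with `n + 2` total derivatives. Taking `f = (u
  -- - a)^{n+2}/(n+2)!` leaves `(-u_x)^{n+2} ∂Y/∂u^{(n+2)} = 0`, so the order of `Y` drops until
  -- only `u_x` remains.
  have red : ∀ n, Y.vars ⊆ Finset.range (n + 1) → Y.vars ⊆ Finset.range 1 := by
    intro n
    induction n with
    | zero => exact id
    | succ n ih =>
      intro hn
      refine ih fun i hi => ?_
      have h0 : MvPolynomial.pderiv (n + 1) Y = 0 := by
        refine eq_zero_of_atPoint fun u => ?_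
        have := congrArg (atPoint u) (hv (Smooth.divPow u (n + 2)) _ hn)
        rw [Finset.sum_range_succ, map_add, map_add, map_add, map_sum,
          Finset.sum_eq_zero (fun k hk => atPoint_neg_dx_pow_divPow_of_lt u
            (by have := Finset.mem_range.1 hk; omega) _), atPoint_neg_dx_pow_divPow,
          Smooth.der_divPow_succ, map_mul, map_mul, atPoint_fn, atPoint_fn,
          Smooth.divPow_apply_succ, Smooth.divPow_apply_succ] at this
        simpa using this
      have h1 := Finset.mem_range.1 (hn hi)
      have h2 : i ≠ n + 1 := fun e => notMem_vars_of_pderiv_eq_zero h0 (e ▸ hi)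
      exact Finset.mem_range.2 (by omega)
  obtain ⟨N, hN⟩ := vars_subset_range Y
  have hvars := red N (hN _ N.le_succ)
  -- Taking `f = u - a` now gives Euler's identity `Y = u_x ∂Y/∂u_x`, so `Y` is linear in `u_x`.
  -- Degree at least two excludes this; the bound is needed since `f(u) u_x` is always null on an
  -- interval.
  have hE : Y = jet 0 * MvPolynomial.pderiv 0 Y := by
    refine ext_atPoint fun u => ?_
    have := congrArg (atPoint u) (hv (Smooth.divPow u 1) _ hvars)
    rw [Finset.sum_range_one, map_add, map_add, atPoint_neg_dx_pow_divPow,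
      Smooth.der_divPow_succ, map_mul, map_mul, atPoint_fn, atPoint_fn,
      Smooth.divPow_apply_succ, Smooth.divPow_apply_zero] at this
    rw [map_mul, atPoint_jet, ← sub_eq_zero]
    simpa [sub_eq_add_neg] using this
  ext1 m
  by_contra hm
  have hw := hY m hm
  have hs : m = Finsupp.single 0 (m 0) := by
    ext i
    rcases Nat.eq_zero_or_pos i with rfl | hi
    · simp
    · rw [Finsupp.single_eq_of_ne (by omega)]
      by_contra hne
      have := hvars ((MvPolynomial.mem_vars_iff_mem_support i).2
        ⟨m, MvPolynomial.mem_support_iff.2 hm, Finsupp.mem_support_iff.2 hne⟩)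
      rw [Finset.mem_range] at this; omega
  have h2 : 2 ≤ m 0 := by
    rw [hs, Finsupp.weight_single] at hw
    simpa using hw
  have hc := congrArg (MvPolynomial.coeff m) hE
  have hm' : m - Finsupp.single 0 1 + Finsupp.single 0 1 = m :=
    tsub_add_cancel_of_le (Finsupp.single_le_iff.2 (by omega))
  rw [jet, MvPolynomial.coeff_X_mul', if_pos (Finsupp.mem_support_iff.2 (by omega)),
    MvPolynomial.coeff_pderiv, hm'] at hc
  refine hm (Smooth.ext fun u => ?_)
  have hu := congrArg (fun f => Smooth.evalHom u f) hc
  simp only [map_mul, map_add, map_natCast, map_one, Smooth.evalHom_apply] at hu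
  have h3 : ((m - Finsupp.single 0 1 : ℕ →₀ ℕ) 0 : ℝ) = (m 0 : ℝ) - 1 := by
    rw [Finsupp.tsub_apply, Finsupp.single_eq_same, Nat.cast_sub (by omega)]; simp
  rw [h3] at hu
  have h4 : (2 : ℝ) ≤ m 0 := by exact_mod_cast h2
  have h5 : (MvPolynomial.coeff m Y u) * ((m 0 : ℝ) - 1) = 0 := by linarith
  exact (mul_eq_zero.1 h5).resolve_right (by linarith)

/-! ### Differential operators and their adjoints -/

theorem act_eq (A : DiffOp I) (F : DiffPoly I) : A.act F = A.sum fun j a => a * (dx ^ j) F := by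
  simp only [DiffOp.act, iterate_totalD]

/-- A differential operator is determined by its values on functions of `u`. -/
theorem diffOp_eq_zero {A : DiffOp I} (h : ∀ f, A.act (fn f) = 0) : A = 0 := by
  by_contra hA
  have hne := Finsupp.support_nonempty_iff.2 hA
  set k := A.support.max' hne with hk
  refine Finsupp.mem_support_iff.1 (A.support.max'_mem hne) ?_
  rw [← hk]
  refine eq_zero_of_atPoint fun u => ?_
  have hd (j : ℕ) (F : DiffPoly I) : (dx ^ j) F = (-1) ^ j * ((-dx) ^ j) F := by
    rw [neg_dx_pow, ← mul_assoc, ← mul_pow]; simp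
  -- Applied to the divided power of exponent the order `k`, all lower terms vanish at the point and
  -- `A_k u_x^k` is left up to sign.
  have hz := congrArg (atPoint u) (h (Smooth.divPow u k))
  rw [act_eq, Finsupp.sum, map_sum, Finset.sum_eq_single_of_mem k (A.support.max'_mem hne)] at hz
  · have := atPoint_neg_dx_pow_divPow u k 1
    rw [mul_one] at this
    rw [map_mul, hd, map_mul, this] at hz
    simpa using hz
  · intro j hj hjk
    have := atPoint_neg_dx_pow_divPow_of_lt u (lt_of_le_of_ne (A.support.le_max' j hj) hjk) 1
    rw [mul_one] at this
    rw [map_mul, hd, map_mul, this, mul_zero, mul_zero]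

theorem act_add_left (A B : DiffOp I) (F : DiffPoly I) : (A + B).act F = A.act F + B.act F := by
  rw [act_eq, act_eq, act_eq, Finsupp.sum_add_index'] <;> intros <;> ring

theorem act_smul_left (r : ℝ) (A : DiffOp I) (F : DiffPoly I) : (r • A).act F = r • A.act F := by
  rw [act_eq, act_eq, Finsupp.sum_smul_index' (by simp), Finsupp.smul_sum]
  simp

theorem act_neg_left (A : DiffOp I) (F : DiffPoly I) : (-A).act F = -A.act F := by
  have := act_smul_left (-1) A F; simpa using this

theorem act_sub_left (A B : DiffOp I) (F : DiffPoly I) : (A - B).act F = A.act F - B.act F := by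
  rw [sub_eq_add_neg, act_add_left, act_neg_left, sub_eq_add_neg]

theorem act_zero_left (F : DiffPoly I) : (0 : DiffOp I).act F = 0 := by
  rw [act_eq, Finsupp.sum_zero_index]

theorem act_single (j : ℕ) (a F : DiffPoly I) :
    DiffOp.act (Finsupp.single j a) F = a * (dx ^ j) F := by
  rw [act_eq, Finsupp.sum_single_index (by simp)]

theorem act_smul (r : ℝ) (A : DiffOp I) (F : DiffPoly I) : A.act (r • F) = r • A.act F := by
  simp only [act_eq, map_smul, mul_smul_comm, Finsupp.smul_sum]

/-- The maps given by differential operators. -/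
def IsDiffOp (T : DiffPoly I → DiffPoly I) : Prop := ∃ A : DiffOp I, ∀ F, T F = A.act F

namespace IsDiffOp

variable {S T : DiffPoly I → DiffPoly I}

theorem act (A : DiffOp I) : IsDiffOp A.act := ⟨A, fun _ => rfl⟩

theorem id : IsDiffOp (fun F : DiffPoly I => F) :=
  ⟨Finsupp.single 0 1, fun F => by simp [act_single]⟩

theorem zero : IsDiffOp (fun _ : DiffPoly I => 0) := ⟨0, fun F => (act_zero_left F).symm⟩

theorem add (hS : IsDiffOp S) (hT : IsDiffOp T) : IsDiffOp fun F => S F + T F := by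
  obtain ⟨A, hA⟩ := hS
  obtain ⟨B, hB⟩ := hT
  exact ⟨A + B, fun F => by simp only [act_add_left, hA, hB]⟩

theorem sum {ι : Type*} {s : Finset ι} {T : ι → DiffPoly I → DiffPoly I}
    (h : ∀ i ∈ s, IsDiffOp (T i)) : IsDiffOp fun F => ∑ i ∈ s, T i F := by
  induction s using Finset.cons_induction with
  | empty => simpa using zero
  | cons a s ha ih =>
    simp only [Finset.sum_cons]
    exact (h a (Finset.mem_cons_self a s)).add (ih fun i hi => h i (Finset.mem_cons_of_mem hi))

theorem mul (a : DiffPoly I) (hT : IsDiffOp T) : IsDiffOp fun F => a * T F := by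
  obtain ⟨A, hA⟩ := hT
  refine ⟨A.mapRange (a * ·) (mul_zero a), fun F => ?_⟩
  simp only [hA]
  rw [act_eq, act_eq, Finsupp.sum_mapRange_index (by simp), Finsupp.mul_sum]
  simp only [mul_assoc]

theorem mul' (a : DiffPoly I) (hT : IsDiffOp T) : IsDiffOp fun F => T F * a := by
  simpa only [mul_comm] using hT.mul a

theorem dx_comp (hT : IsDiffOp T) : IsDiffOp fun F => dx (T F) := by
  obtain ⟨A, hA⟩ := hT
  have : (fun F => dx (T F)) = fun F => ∑ j ∈ A.support,
      (DiffOp.act (Finsupp.single (j + 1) (A j) + Finsupp.single j (dx (A j))) F) := by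
    funext F
    rw [hA, act_eq, Finsupp.sum, map_sum]
    refine Finset.sum_congr rfl fun j _ => ?_
    rw [dx_mul, act_add_left, act_single, act_single, dx_pow_succ, mul_comm (dx (A j))]
  rw [this]
  exact sum fun j _ => act _

theorem dx_pow_comp (k : ℕ) (hT : IsDiffOp T) : IsDiffOp fun F => (dx ^ k) (T F) := by
  induction k with
  | zero => exact hT
  | succ k ih => simpa only [dx_pow_succ] using ih.dx_comp

theorem neg_dx_pow_comp (k : ℕ) (hT : IsDiffOp T) : IsDiffOp fun F => ((-dx) ^ k) (T F) := by
  simpa only [neg_dx_pow] using (hT.dx_pow_comp k).mul _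

theorem eq_zero (hT : IsDiffOp T) (h : ∀ f, T (fn f) = 0) (F : DiffPoly I) : T F = 0 := by
  obtain ⟨A, hA⟩ := hT
  rw [hA, diffOp_eq_zero fun f => (hA _).symm.trans (h f), act_zero_left]

end IsDiffOp

/-- The formal adjoint of a differential operator. -/
def adjoint (A : DiffOp I) (F : DiffPoly I) : DiffPoly I := A.sum fun j a => ((-dx) ^ j) (a * F)

theorem loc_mul_act (A : DiffOp I) (a b : DiffPoly I) :
    loc (a * A.act b) = loc (adjoint A a * b) := by
  rw [act_eq, adjoint, Finsupp.sum, Finsupp.sum, Finset.mul_sum, Finset.sum_mul, map_sum, map_sum]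
  refine Finset.sum_congr rfl fun j _ => ?_
  rw [← mul_assoc, loc_mul_dx_pow, mul_comm a]

theorem IsDiffOp.adjoint_comp (A : DiffOp I) {T : DiffPoly I → DiffPoly I} (hT : IsDiffOp T) :
    IsDiffOp fun F => adjoint A (T F) := by
  simp only [adjoint, Finsupp.sum]
  exact sum fun j _ => (hT.mul _).neg_dx_pow_comp j

/-- The coefficients of `A` satisfy the degree bound of a homogeneous operator of degree `d`. -/
def OpDeg (A : DiffOp I) (d : ℕ) : Prop := ∀ j, A j ∈ degGE (d - j) ∧ (d < j → A j = 0)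

theorem OpDeg.act_mem {A : DiffOp I} {d e k : ℕ} (h : OpDeg A d) (hk : k ≤ d + e) {F : DiffPoly I}
    (hF : F ∈ degGE e) : A.act F ∈ degGE k := by
  rw [act_eq]
  refine sum_mem fun j _ => mul_mem_degGE ?_ (h j).1 (dx_pow_mem_degGE hF j)
  omega

theorem OpDeg.adjoint_mem {A : DiffOp I} {d e k : ℕ} (h : OpDeg A d) (hk : k ≤ d + e)
    {F : DiffPoly I} (hF : F ∈ degGE e) : adjoint A F ∈ degGE k := by
  refine sum_mem fun j _ => degGE_anti ?_
    (neg_dx_pow_mem_degGE (mul_mem_degGE le_rfl (h j).1 hF) j)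
  omega

/-! ### The trivector and the Jacobi identity -/

theorem sum_ite_sum_ite {ι M : Type*} [Fintype ι] [AddCommMonoid M] (σ : ι → ℕ) (m : ℕ) (n : Fin 6)
    (f : ι → M) :
    (∑ j : Fin 6, if m + (j : ℕ) = n then ∑ y, (if σ y = j then f y else 0) else 0) =
      ∑ y, if m + σ y = n then f y else 0 := by
  have h : ∀ j : Fin 6, (if m + (j : ℕ) = n then ∑ y, (if σ y = j then f y else 0) else 0) =
      ∑ y, if m + (j : ℕ) = n ∧ σ y = j then f y else 0 := by
    intro j
    split_ifs with h <;> simp [h]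
  simp only [h]
  rw [Finset.sum_comm]
  refine Finset.sum_congr rfl fun y _ => ?_
  split_ifs with h
  · have hlt : σ y < 6 := by omega
    rw [Finset.sum_eq_single_of_mem ⟨σ y, hlt⟩ (Finset.mem_univ _)]
    · simp [h]
    · intro j _ hj
      rw [if_neg]
      rintro ⟨-, h2⟩
      exact hj (Fin.ext h2.symm)
  · refine Finset.sum_eq_zero fun j _ => if_neg ?_
    rintro ⟨h1, h2⟩
    omega

theorem field_apply (L : Ser (DiffOp I)) (G : Ser (DiffPoly I)) (n : Fin 6) :
    field L G n = ∑ z : Fin 6 × Fin 6,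
      if (z.1 : ℕ) + z.2 = n then (L z.1).act (varD (G z.2)) else 0 := by
  rw [Fintype.sum_prod_type]; rfl

theorem bracket_apply (L : Ser (DiffOp I)) (F G : Ser (DiffPoly I)) (n : Fin 6) :
    bracket L F G n = ∑ y : Fin 6 × Fin 6 × Fin 6, if (y.1 : ℕ) + (y.2.1 + y.2.2) = n then
      varD (F y.1) * (L y.2.1).act (varD (G y.2.2)) else 0 := by
  rw [Fintype.sum_prod_type]
  change (∑ i : Fin 6, ∑ j : Fin 6, if (i : ℕ) + (j : ℕ) = n then varD (F i) * field L G j else 0)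
    = _
  refine Finset.sum_congr rfl fun i _ => ?_
  refine Eq.trans ?_ (sum_ite_sum_ite (M := DiffPoly I) (fun z : Fin 6 × Fin 6 => (z.1 : ℕ) + z.2)
    i n fun z => varD (F i) * (L z.1).act (varD (G z.2)))
  refine Finset.sum_congr rfl fun j _ => ?_
  rw [field_apply, Finset.mul_sum]
  simp only [mul_ite, mul_zero]

/-- The derivative of the coefficients of a differential operator along `X`. -/
def prOp (X : DiffPoly I) (A : DiffOp I) (b : DiffPoly I) : DiffPoly I :=
  ∑ j ∈ A.support, pr X (A j) * (dx ^ j) b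

theorem pr_act (X : DiffPoly I) (A : DiffOp I) (b : DiffPoly I) :
    pr X (A.act b) = prOp X A b + A.act (pr X b) := by
  rw [act_eq, act_eq, prOp, Finsupp.sum, Finsupp.sum, map_sum, ← Finset.sum_add_distrib]
  refine Finset.sum_congr rfl fun j _ => ?_
  rw [Derivation.leibniz, pr_dx_pow, smul_eq_mul, smul_eq_mul]
  ring

/-- `loc (w * pr X F) = loc (euler w F * X)`. -/
def euler (w F : DiffPoly I) : DiffPoly I :=
  w * partialU F + ∑ n ∈ F.vars, ((-dx) ^ (n + 1)) (w * MvPolynomial.pderiv n F)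

theorem loc_mul_pr (w X F : DiffPoly I) : loc (w * pr X F) = loc (euler w F * X) := by
  rw [pr_apply subset_rfl, euler, mul_add, add_mul, map_add, map_add, Finset.sum_mul,
    Finset.mul_sum, map_sum, map_sum]
  congr 1
  · congr 1; ring
  · refine Finset.sum_congr rfl fun n _ => ?_
    rw [← loc_mul_dx_pow]
    congr 1; ring

theorem euler_mem_degGE {d e k : ℕ} (hk : k ≤ d + e) {w F : DiffPoly I} (hw : w ∈ degGE e)
    (hF : F ∈ degGE d) : euler w F ∈ degGE k := by
  refine add_mem (mul_mem_degGE (by omega) hw (partialU_mem_degGE hF)) (sum_mem fun n _ => ?_)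
  exact degGE_anti (by omega)
    (neg_dx_pow_mem_degGE (mul_mem_degGE le_rfl hw (pderiv_mem_degGE hF n)) (n + 1))

theorem IsDiffOp.euler_comp (F : DiffPoly I) {T : DiffPoly I → DiffPoly I} (hT : IsDiffOp T) :
    IsDiffOp fun w => euler (T w) F :=
  (hT.mul' _).add (IsDiffOp.sum fun n _ => (hT.mul' _).neg_dx_pow_comp (n + 1))

theorem IsDiffOp.pr_comp (F : DiffPoly I) {T : DiffPoly I → DiffPoly I} (hT : IsDiffOp T) :
    IsDiffOp fun w => pr (T w) F := by
  simp only [pr_apply (F := F) subset_rfl]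
  exact (hT.mul' _).add (IsDiffOp.sum fun n _ => (hT.dx_pow_comp (n + 1)).mul' _)

/-- `T` is a local trilinear form `(a, b, c) ↦ ∫ M(a, b) c dx`, with `M` a bidifferential operator
whose values have degree at least two. -/
def IsLocalForm (T : DiffPoly I → DiffPoly I → DiffPoly I →
    DiffPoly I ⧸ LinearMap.range (dx : Module.End ℝ (DiffPoly I))) : Prop :=
  ∃ M : DiffPoly I → DiffPoly I → DiffPoly I, (∀ a b c, T a b c = loc (M a b * c)) ∧
    (∀ a, IsDiffOp (M a)) ∧ (∀ b, IsDiffOp fun a => M a b) ∧ ∀ a b, M a b ∈ degGE 2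

namespace IsLocalForm

theorem zero : IsLocalForm (I := I) fun _ _ _ => 0 :=
  ⟨fun _ _ => 0, by simp, fun _ => IsDiffOp.zero, fun _ => IsDiffOp.zero, fun _ _ => zero_mem _⟩

theorem add {S T : DiffPoly I → DiffPoly I → DiffPoly I →
    DiffPoly I ⧸ LinearMap.range (dx : Module.End ℝ (DiffPoly I))} (hS : IsLocalForm S)
    (hT : IsLocalForm T) : IsLocalForm fun a b c => S a b c + T a b c := by
  obtain ⟨M, h1, h2, h3, h4⟩ := hS
  obtain ⟨N, k1, k2, k3, k4⟩ := hT
  exact ⟨fun a b => M a b + N a b, fun a b c => by simp only [h1, k1, add_mul, map_add],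
    fun a => (h2 a).add (k2 a), fun b => (h3 b).add (k3 b), fun a b => add_mem (h4 a b) (k4 a b)⟩

theorem sum {ι : Type*} {s : Finset ι} {T : ι → DiffPoly I → DiffPoly I → DiffPoly I →
    DiffPoly I ⧸ LinearMap.range (dx : Module.End ℝ (DiffPoly I))}
    (hT : ∀ i ∈ s, IsLocalForm (T i)) : IsLocalForm fun a b c => ∑ i ∈ s, T i a b c := by
  induction s using Finset.cons_induction with
  | empty => simpa using zero
  | cons a s ha ih =>
    simp only [Finset.sum_cons]
    exact (hT a (Finset.mem_cons_self a s)).add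
      (ih fun i hi => hT i (Finset.mem_cons_of_mem hi))

/-- For functions `a` and `b`, pairing `M a b` with all functions kills it by
`eq_zero_of_loc_fn_mul`. Since `M` is a differential operator in each argument, vanishing on
functions extends first in `b`, then in `a`. -/
theorem eq_zero {T : DiffPoly I → DiffPoly I → DiffPoly I →
    DiffPoly I ⧸ LinearMap.range (dx : Module.End ℝ (DiffPoly I))} (hT : IsLocalForm T)
    (h : ∀ f g k, T (fn f) (fn g) (fn k) = 0) (a b c : DiffPoly I) : T a b c = 0 := by
  obtain ⟨M, h1, h2, h3, h4⟩ := hT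
  have : M a b = 0 := (h3 b).eq_zero (fun f => (h2 _).eq_zero (fun g =>
    eq_zero_of_loc_fn_mul (h4 _ _) fun k => by rw [mul_comm, ← h1, h]) b) a
  rw [h1, this, zero_mul, map_zero]

end IsLocalForm

/-- The three terms of the trivector of the pair of operators `A`, `B`. -/
def trivector (A B : DiffOp I) (a b c : DiffPoly I) :
    DiffPoly I ⧸ LinearMap.range (dx : Module.End ℝ (DiffPoly I)) :=
  loc (a * prOp (A.act c) B b) + loc (b * prOp (A.act a) B c) + loc (c * prOp (A.act b) B a)

/-- Each term is rewritten so that `c` carries no derivatives. The first needs two adjoints, of the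
linearized coefficients and of `A`; the second needs ordinary integration by parts; the third is
already of this form. The degrees of the two operators add up to `m + n + 2`, which is at least two
even at leading order. -/
theorem isLocalForm_trivector {A B : DiffOp I} {m n : ℕ} (hA : OpDeg A (m + 1))
    (hB : OpDeg B (n + 1)) : IsLocalForm (trivector A B) := by
  have h0 : ∀ F : DiffPoly I, F ∈ degGE 0 := mem_degGE_zero
  have hpr : ∀ a j, pr (A.act a) (B j) ∈ degGE ((n + 1 - j) + (m + 1)) := fun a j =>
    pr_mem_degGE le_rfl (hA.act_mem le_rfl (h0 a)) (hB j).1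
  refine ((IsLocalForm.add ?_ ?_).add ?_)
  · refine ⟨fun a b => ∑ j ∈ B.support, adjoint A (euler (a * (dx ^ j) b) (B j)),
      fun a b c => ?_, fun a => ?_, fun b => ?_, fun a b => ?_⟩
    · simp only [prOp, Finset.mul_sum, Finset.sum_mul, map_sum]
      refine Finset.sum_congr rfl fun j _ => ?_
      rw [← loc_mul_act, ← loc_mul_pr]
      congr 1; ring
    · exact IsDiffOp.sum fun j _ =>
        (((IsDiffOp.id.dx_pow_comp j).mul a).euler_comp _).adjoint_comp A
    · exact IsDiffOp.sum fun j _ => ((IsDiffOp.id.mul' _).euler_comp _).adjoint_comp A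
    · refine sum_mem fun j _ => hA.adjoint_mem (e := (n + 1 - j) + j) (by omega) ?_
      exact euler_mem_degGE le_rfl (mul_mem_degGE (by omega) (h0 a) (dx_pow_mem_degGE (h0 b) j))
        (hB j).1
  · refine ⟨fun a b => ∑ j ∈ B.support, ((-dx) ^ j) (b * pr (A.act a) (B j)),
      fun a b c => ?_, fun a => ?_, fun b => ?_, fun a b => ?_⟩
    · simp only [prOp, Finset.mul_sum, Finset.sum_mul, map_sum]
      refine Finset.sum_congr rfl fun j _ => ?_
      rw [← loc_mul_dx_pow, mul_assoc]
    · exact IsDiffOp.sum fun j _ => (IsDiffOp.id.mul' _).neg_dx_pow_comp j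
    · exact IsDiffOp.sum fun j _ => (((IsDiffOp.act A).pr_comp _).mul b).neg_dx_pow_comp j
    · exact sum_mem fun j _ => degGE_anti (by omega)
        (neg_dx_pow_mem_degGE (Ideal.mul_mem_left _ b (hpr a j)) j)
  · refine ⟨fun a b => prOp (A.act b) B a, fun a b c => by rw [mul_comm], fun a => ?_, fun b => ?_,
      fun a b => ?_⟩
    · exact IsDiffOp.sum fun j _ => ((IsDiffOp.act A).pr_comp _).mul' _
    · exact IsDiffOp.sum fun j _ => (IsDiffOp.id.dx_pow_comp j).mul _
    · exact sum_mem fun j _ => mul_mem_degGE (e := j) (by omega) (hpr b j)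
        (degGE_anti (by omega) (dx_pow_mem_degGE (h0 a) j))

/-- Skew-adjointness of a differential operator. -/
def IsSkew (A : DiffOp I) : Prop := ∀ a b, loc (a * A.act b) + loc (b * A.act a) = 0

/-- The Leibniz rule varies `a`, the coefficients of `B`, and `b`; skewness of `B` then moves `B`
off the variation of `b`. -/
theorem loc_pr_mul_act {A B : DiffOp I} (hB : IsSkew B) (a b c : DiffPoly I) :
    loc (pr (A.act c) (a * B.act b)) = loc (pr (A.act c) a * B.act b)
      - loc (pr (A.act c) b * B.act a) + loc (a * prOp (A.act c) B b) := by
  rw [Derivation.leibniz, pr_act, smul_eq_mul, smul_eq_mul, mul_add, map_add, map_add,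
    eq_neg_of_add_eq_zero_left (hB a _), mul_comm (B.act b)]
  abel

/-- The terms that vary gradients cancel because linearized gradients are self-adjoint. This
cancellation exchanges the roles of `A` and `B`, so for different operators it is available only in
the symmetrized sum. -/
theorem sum_loc_pr_mul_act {A B : DiffOp I} (hA : IsSkew A) (hB : IsSkew B) (F G H : DiffPoly I) :
    let E := fun (A B : DiffOp I) (a b c : DiffPoly I) => loc (pr (A.act c) (a * B.act b))
    let S := fun (A B : DiffOp I) => E A B (varD F) (varD G) (varD H) +
      E A B (varD G) (varD H) (varD F) + E A B (varD H) (varD F) (varD G)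
    S A B + S B A = trivector A B (varD F) (varD G) (varD H)
      + trivector B A (varD F) (varD G) (varD H) := by
  simp only [loc_pr_mul_act hA, loc_pr_mul_act hB, trivector]
  rw [loc_pr_varD_mul F (A.act (varD H)), loc_pr_varD_mul G (A.act (varD H)),
    loc_pr_varD_mul G (A.act (varD F)), loc_pr_varD_mul H (A.act (varD F)),
    loc_pr_varD_mul H (A.act (varD G)), loc_pr_varD_mul F (A.act (varD G))]
  abel

/-- Summation over the components of total order `n` in the expansion of an expression that is
bilinear in a series of operators and trilinear in series of densities. -/
theorem loc_bracket_bracket (L : Ser (DiffOp I)) (F G H : Ser (DiffPoly I)) (n : Fin 6) :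
    loc (bracket L (bracket L F G) H n) = ∑ w : Fin 6 × Fin 6, ∑ v : Fin 6 × Fin 6 × Fin 6,
      if (w.1 : ℕ) + w.2 + (v.1 + v.2.1 + v.2.2) = n then
        loc (pr ((L w.1).act (varD (H v.2.2))) (varD (F v.1) * (L w.2).act (varD (G v.2.1))))
      else 0 := by
  have h1 : loc (bracket L (bracket L F G) H n) = ∑ z : Fin 6 × Fin 6, ∑ i : Fin 6,
      if (z.1 + z.2 : ℕ) + i = n then ∑ y : Fin 6 × Fin 6 × Fin 6,
        (if (y.1 : ℕ) + (y.2.1 + y.2.2) = i then loc (pr ((L z.1).act (varD (H z.2)))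
          (varD (F y.1) * (L y.2.1).act (varD (G y.2.2)))) else 0) else 0 := by
    rw [bracket_apply, Fintype.sum_prod_type, Finset.sum_comm, map_sum]
    refine Finset.sum_congr rfl fun z _ => ?_
    rw [map_sum]
    refine Finset.sum_congr rfl fun i _ => ?_
    simp only [add_comm (i : ℕ), apply_ite loc, map_zero, loc_varD_mul]
    congr 1
    rw [bracket_apply, map_sum, map_sum]
    simp only [apply_ite loc, apply_ite (pr _), map_zero]
  simp only [h1, sum_ite_sum_ite (fun y : Fin 6 × Fin 6 × Fin 6 => (y.1 : ℕ) + (y.2.1 + y.2.2))]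
  rw [← Fintype.sum_prod_type', ← Fintype.sum_prod_type']
  refine Fintype.sum_equiv ⟨fun x => ((x.1.1, x.2.2.1), (x.2.1, x.2.2.2, x.1.2)),
    fun x => ((x.1.1, x.2.2.2), (x.2.1, x.1.2, x.2.2.1)),
    fun _ => rfl, fun _ => rfl⟩ _ _ fun x => ?_
  refine if_congr ?_ rfl rfl
  simp only [Equiv.coe_fn_mk]
  omega

theorem sum_rotate {M : Type*} [AddCommMonoid M] (f : Fin 6 × Fin 6 × Fin 6 → M) :
    ∑ v, f v = ∑ v : Fin 6 × Fin 6 × Fin 6, f (v.2.1, v.2.2, v.1) :=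
  Fintype.sum_equiv ⟨fun x => (x.2.2, x.1, x.2.1), fun x => (x.2.1, x.2.2, x.1),
    fun _ => rfl, fun _ => rfl⟩ _ _ fun _ => rfl

theorem loc_jacobi {L : Ser (DiffOp I)} (hL : ∀ n, IsSkew (L n)) (F G H : Ser (DiffPoly I))
    (n : Fin 6) :
    loc ((bracket L (bracket L F G) H + bracket L (bracket L G H) F
      + bracket L (bracket L H F) G) n) =
    ∑ v : Fin 6 × Fin 6 × Fin 6, ∑ w : Fin 6 × Fin 6,
      if (w.1 : ℕ) + w.2 + (v.1 + v.2.1 + v.2.2) = n then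
        trivector (L w.1) (L w.2) (varD (F v.1)) (varD (G v.2.1)) (varD (H v.2.2)) else 0 := by
  rw [Finset.sum_comm]
  set E := fun (A B : DiffOp I) (a b c : DiffPoly I) => loc (pr (A.act c) (a * B.act b)) with hE
  set S := fun (w : Fin 6 × Fin 6) (v : Fin 6 × Fin 6 × Fin 6) =>
    E (L w.1) (L w.2) (varD (F v.1)) (varD (G v.2.1)) (varD (H v.2.2)) +
      E (L w.1) (L w.2) (varD (G v.2.1)) (varD (H v.2.2)) (varD (F v.1)) +
      E (L w.1) (L w.2) (varD (H v.2.2)) (varD (F v.1)) (varD (G v.2.1)) with hS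
  have h1 : loc ((bracket L (bracket L F G) H + bracket L (bracket L G H) F
      + bracket L (bracket L H F) G) n) = ∑ w : Fin 6 × Fin 6, ∑ v : Fin 6 × Fin 6 × Fin 6,
      if (w.1 : ℕ) + w.2 + (v.1 + v.2.1 + v.2.2) = n then S w v else 0 := by
    rw [Pi.add_apply, Pi.add_apply, map_add, map_add, loc_bracket_bracket, loc_bracket_bracket,
      loc_bracket_bracket, ← Finset.sum_add_distrib, ← Finset.sum_add_distrib]
    refine Finset.sum_congr rfl fun w _ => ?_
    conv_lhs =>
      enter [1, 2]
      rw [sum_rotate]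
    conv_lhs =>
      enter [2]
      rw [sum_rotate, sum_rotate]
    rw [← Finset.sum_add_distrib, ← Finset.sum_add_distrib]
    refine Finset.sum_congr rfl fun v _ => ?_
    have e1 : ((v.2.1 : ℕ) + v.2.2 + v.1) = v.1 + v.2.1 + v.2.2 := by omega
    have e2 : ((v.2.2 : ℕ) + v.1 + v.2.1) = v.1 + v.2.1 + v.2.2 := by omega
    simp only [e1, e2]
    split_ifs <;> simp [hS, hE]
  have h2 : ∀ f : Fin 6 × Fin 6 → Fin 6 × Fin 6 × Fin 6 →
      DiffPoly I ⧸ LinearMap.range (dx : Module.End ℝ (DiffPoly I)),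
      (∑ w : Fin 6 × Fin 6, ∑ v : Fin 6 × Fin 6 × Fin 6,
        if (w.1 : ℕ) + w.2 + (v.1 + v.2.1 + v.2.2) = n then f w v else 0) +
      (∑ w : Fin 6 × Fin 6, ∑ v : Fin 6 × Fin 6 × Fin 6,
        if (w.1 : ℕ) + w.2 + (v.1 + v.2.1 + v.2.2) = n then f w v else 0) =
      ∑ w : Fin 6 × Fin 6, ∑ v : Fin 6 × Fin 6 × Fin 6,
        if (w.1 : ℕ) + w.2 + (v.1 + v.2.1 + v.2.2) = n then f w v + f w.swap v else 0 := by
    intro f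
    conv_lhs =>
      enter [2]
      rw [← (Equiv.prodComm (Fin 6) (Fin 6)).sum_comp]
    rw [← Finset.sum_add_distrib]
    refine Finset.sum_congr rfl fun w _ => ?_
    rw [← Finset.sum_add_distrib]
    refine Finset.sum_congr rfl fun v _ => ?_
    simp only [Equiv.prodComm_apply, Prod.fst_swap, Prod.snd_swap, add_comm (w.2 : ℕ)]
    split_ifs <;> simp
  rw [h1]
  -- Doubling the sum and swapping the two operator indices in one copy produces the symmetrization
  -- required by `sum_loc_pr_mul_act`.
  refine smul_right_injective _ (two_ne_zero : (2 : ℝ) ≠ 0) ?_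
  simp only [two_smul]
  rw [h2, h2]
  refine Finset.sum_congr rfl fun w _ => Finset.sum_congr rfl fun v _ => ?_
  congr 1
  exact sum_loc_pr_mul_act (hL w.1) (hL w.2) _ _ _

/-! ### Commuting Hamiltonians force the Poisson property -/

theorem isNull_iff {F : Ser (DiffPoly I)} : IsNull F ↔ ∀ n, loc (F n) = 0 :=
  forall_congr' fun _ => loc_eq_zero.symm

theorem varD_fn (f : Smooth I) : varD (fn f) = fn (der f) := by
  rw [varD_eq (s := ∅) (by simp [fn])]; simp

theorem varD_zero : varD (0 : DiffPoly I) = 0 := by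
  have := varD_fn (0 : Smooth I)
  simpa [fn] using this

theorem IsDeformation.opDeg {A : DiffOp I} {L : Ser (DiffOp I)} (h : IsDeformation A L)
    (n : Fin 6) : OpDeg (L n) (n + 1) := by
  intro j
  by_cases hj : L n j = 0
  · exact ⟨hj ▸ zero_mem _, fun _ => hj⟩
  · obtain ⟨d, hd, hdeg⟩ := h.graded n j hj
    exact ⟨degGE_anti (by omega) hdeg.mem_degGE, fun hlt => by omega⟩

theorem secondOp_act (q : Smooth I) (F : DiffPoly I) :
    (secondOp q).act F = fn q * dx F + fn ((1 / 2 : ℝ) • der q) * jet 0 * F := by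
  rw [secondOp, act_add_left, act_single, act_single, pow_one, pow_zero, Module.End.one_apply]

theorem isSkew_secondOp (q : Smooth I) : IsSkew (secondOp q) := by
  intro a b
  rw [← map_add, secondOp_act, secondOp_act]
  have h2 : fn ((1 / 2 : ℝ) • der q) + fn ((1 / 2 : ℝ) • der q) = fn (der q) := by
    rw [fn, fn, ← map_add]
    congr 1
    exact Smooth.ext fun u => by simp; ring
  -- The coefficient `½ q' u_x` is exactly what makes the symmetric part the total derivative of `q
  -- a b`.
  have : a * (fn q * dx b + fn ((1 / 2 : ℝ) • der q) * jet 0 * b) +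
      b * (fn q * dx a + fn ((1 / 2 : ℝ) • der q) * jet 0 * a) = dx (fn q * (a * b)) := by
    rw [dx_mul, dx_mul, dx_fn, ← h2]; ring
  rw [this, loc_dx]

section Commuting

variable {q : Smooth I} {L : Ser (DiffOp I)} {H : Smooth I → Ser (DiffPoly I)}

/-- The sum `{H_f, H_g} + {H_g, H_f}` at order `n` reduces, by skewness at lower orders, to the
symmetric part of `L_n` on `f'` and `g'`. As `f` and `g` vary these are arbitrary functions, and the
test principles show that `L_n` plus its adjoint is zero. -/
theorem isSkew_of_commute (hI : IsConnected (I : Set ℝ)) (hL : IsDeformation (secondOp q) L)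
    (hH : ∀ f, H f 0 = fn f) (hc : ∀ f g, IsNull (bracket L (H f) (H g))) (n : Fin 6) :
    IsSkew (L n) := by
  obtain ⟨n, hn⟩ := n
  induction n using Nat.strong_induction_on with
  | _ n ih =>
  rcases Nat.eq_zero_or_pos n with rfl | hpos
  · rw [show (⟨0, hn⟩ : Fin 6) = 0 from rfl, hL.leading]
    exact isSkew_secondOp q
  have key : ∀ f g : Smooth I, loc (fn f * (L ⟨n, hn⟩).act (fn g)) +
      loc (fn g * (L ⟨n, hn⟩).act (fn f)) = 0 := by
    intro f' g'
    obtain ⟨f, rfl⟩ := Smooth.exists_der_eq hI f'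
    obtain ⟨g, rfl⟩ := Smooth.exists_der_eq hI g'
    have h1 := isNull_iff.1 (hc f g) ⟨n, hn⟩
    have h2 := isNull_iff.1 (hc g f) ⟨n, hn⟩
    have h3 := congrArg₂ (· + ·) h1 h2
    simp only [add_zero] at h3
    rw [bracket_apply, bracket_apply, map_sum, map_sum] at h3
    -- Reversing the index triple pairs each term of one bracket with its transpose in the other.
    -- Pairs with operator index below `n` vanish by induction, leaving only the triple `(0, n, 0)`.
    have e : ∀ F : Fin 6 × Fin 6 × Fin 6 →
        DiffPoly I ⧸ LinearMap.range (dx : Module.End ℝ (DiffPoly I)),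
        ∑ y, F y = ∑ y : Fin 6 × Fin 6 × Fin 6, F (y.2.2, y.2.1, y.1) := fun F =>
      Fintype.sum_equiv ⟨fun x => (x.2.2, x.2.1, x.1), fun x => (x.2.2, x.2.1, x.1),
        fun _ => rfl, fun _ => rfl⟩ _ _ fun _ => rfl
    rw [e (fun y => loc (if (y.1 : ℕ) + (y.2.1 + y.2.2) = (⟨n, hn⟩ : Fin 6) then
      varD (H g y.1) * (L y.2.1).act (varD (H f y.2.2)) else 0)), ← Finset.sum_add_distrib,
      Finset.sum_eq_single_of_mem (0, ⟨n, hn⟩, 0) (Finset.mem_univ _)] at h3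
    · simpa [hH, varD_fn] using h3
    · rintro ⟨i, k, l⟩ - hne
      simp only [add_comm (l : ℕ), ← add_assoc]
      simp only [add_comm (k : ℕ)]
      split_ifs with h
      · have hk : (k : ℕ) < n := by
          by_contra hk
          refine hne ?_
          simp only [Prod.mk.injEq, Fin.ext_iff, Fin.val_zero]
          omega
        exact ih k hk k.2 _ _
      · simp
  have hz : ∀ F, (L ⟨n, hn⟩).act F + adjoint (L ⟨n, hn⟩) F = 0 := by
    refine ((IsDiffOp.act _).add (IsDiffOp.id.adjoint_comp _)).eq_zero fun g => ?_
    refine eq_zero_of_loc_fn_mul ?_ fun f => ?_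
    · exact add_mem ((hL.opDeg _).act_mem (by simp; omega) (mem_degGE_zero _))
        ((hL.opDeg _).adjoint_mem (by simp; omega) (mem_degGE_zero _))
    · rw [mul_add, map_add, mul_comm _ (adjoint _ _), ← loc_mul_act, key]
  intro a b
  rw [loc_mul_act _ b, mul_comm _ a, ← map_add, ← mul_add, hz, mul_zero, map_zero]

/-- Jacobi holds trivially on commuting Hamiltonians. Their leading gradients exhaust the functions
of `u`, and the trivector is a local form determined by its values on functions, so it vanishes
identically. -/
theorem isPoisson_of_commute (hI : IsConnected (I : Set ℝ)) (hL : IsDeformation (secondOp q) L)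
    (hH : ∀ f, H f 0 = fn f) (hc : ∀ f g, IsNull (bracket L (H f) (H g))) : IsPoisson L := by
  have hskew := isSkew_of_commute hI hL hH hc
  refine ⟨fun F G => isNull_iff.2 fun n => ?_, fun F G K => isNull_iff.2 fun n => ?_⟩
  · rw [Pi.add_apply, map_add, bracket_apply, bracket_apply, map_sum, map_sum]
    rw [Fintype.sum_equiv (⟨fun x => (x.2.2, x.2.1, x.1), fun x => (x.2.2, x.2.1, x.1),
        fun _ => rfl, fun _ => rfl⟩ : Fin 6 × Fin 6 × Fin 6 ≃ Fin 6 × Fin 6 × Fin 6)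
        (fun y => loc (if (y.1 : ℕ) + (y.2.1 + y.2.2) = n then
        varD (G y.1) * (L y.2.1).act (varD (F y.2.2)) else 0)) (fun y =>
        loc (if (y.1 : ℕ) + (y.2.1 + y.2.2) = n then
        varD (G y.2.2) * (L y.2.1).act (varD (F y.1)) else 0)), ← Finset.sum_add_distrib]
    · refine Finset.sum_eq_zero fun y _ => ?_
      split_ifs
      · exact hskew _ _ _
      · simp
    · rintro ⟨i, k, l⟩
      simp only [Equiv.coe_fn_mk]
      congr 1
      refine if_congr ?_ rfl rfl
      omega
  -- Induction on the order of the trivector: in the Jacobi sum for `H_f`, `H_g`, `H_k`,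
  -- contributions of gradients of positive order involve trivectors of lower order, so what remains
  -- is the order `m` trivector on `f'`, `g'`, `k'`.
  have hT : ∀ m (_ : m < 6) (a b c : DiffPoly I), (∑ w : Fin 6 × Fin 6,
      if (w.1 : ℕ) + w.2 = m then trivector (L w.1) (L w.2) a b c else 0) = 0 := by
    intro m hm
    induction m using Nat.strong_induction_on with
    | _ m ih =>
    refine IsLocalForm.eq_zero (IsLocalForm.sum fun w _ => ?_) fun f' g' k' => ?_
    · split_ifs
      · exact isLocalForm_trivector (hL.opDeg _) (hL.opDeg _)
      · exact IsLocalForm.zero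
    obtain ⟨f, rfl⟩ := Smooth.exists_der_eq hI f'
    obtain ⟨g, rfl⟩ := Smooth.exists_der_eq hI g'
    obtain ⟨k, rfl⟩ := Smooth.exists_der_eq hI k'
    -- The inner bracket is null, so its variational derivative vanishes.
    have hbb : ∀ f g k, loc (bracket L (bracket L (H f) (H g)) (H k) ⟨m, hm⟩) = 0 := by
      intro f g k
      rw [bracket_apply, map_sum]
      refine Finset.sum_eq_zero fun y _ => ?_
      rw [varD_eq_zero_of_loc (isNull_iff.1 (hc f g) y.1)]
      simp
    have h0 := loc_jacobi hskew (H f) (H g) (H k) ⟨m, hm⟩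
    rw [Pi.add_apply, Pi.add_apply, map_add, map_add, hbb, hbb, hbb, add_zero, add_zero,
      Finset.sum_eq_single_of_mem (0, 0, 0) (Finset.mem_univ _)] at h0
    · simpa [hH, varD_fn] using h0.symm
    · rintro ⟨i, j, l⟩ - hne
      by_cases hle : (i + j + l : ℕ) ≤ m
      · have hlt : m - (i + j + l : ℕ) < m := by
          have : ¬ ((i + j + l : ℕ) = 0) := fun h => hne (by
            simp only [Prod.mk.injEq, Fin.ext_iff, Fin.val_zero]; omega)
          omega
        refine Eq.trans (Finset.sum_congr rfl fun w _ => if_congr ?_ rfl rfl)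
          (ih _ hlt (by omega) (varD (H f i)) (varD (H g j)) (varD (H k l)))
        simp only
        omega
      · exact Finset.sum_eq_zero fun w _ => if_neg (by simp only; omega)
  rw [loc_jacobi hskew]
  refine Finset.sum_eq_zero fun v _ => ?_
  by_cases hle : (v.1 + v.2.1 + v.2.2 : ℕ) ≤ n
  · exact Eq.trans (Finset.sum_congr rfl fun w _ => if_congr (by omega) rfl rfl)
      (hT (n - (v.1 + v.2.1 + v.2.2 : ℕ)) (by omega) (varD (F v.1)) (varD (G v.2.1))
      (varD (K v.2.2)))
  · exact Finset.sum_eq_zero fun w _ => if_neg (by omega)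

end Commuting

/-! ### Comparing flows and operators order by order -/

theorem act_zero_right (A : DiffOp I) : A.act 0 = 0 := by
  have := act_smul 0 A 0; simpa using this

theorem field_sub_of_eq {L M : Ser (DiffOp I)} {n : Fin 6} (h : ∀ k < n, L k = M k)
    (G : Ser (DiffPoly I)) : field L G n - field M G n = (L n - M n).act (varD (G 0)) := by
  rw [field_apply, field_apply, ← Finset.sum_sub_distrib,
    Finset.sum_eq_single_of_mem (n, 0) (Finset.mem_univ _)]
  · simp [act_sub_left]
  · rintro ⟨k, j⟩ - hne
    split_ifs with hkj
    · simp only at hkj ⊢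
      have hk : k < n := by
        rw [Fin.lt_def]
        by_contra hk
        refine hne ?_
        simp only [Prod.mk.injEq, Fin.ext_iff, Fin.val_zero]
        omega
      rw [h k hk, sub_self]
    · rw [sub_self]

theorem firstOp_apply_zero : firstOp I 0 = Finsupp.single 1 1 := rfl

theorem firstOp_apply_of_ne {n : Fin 6} (hn : n ≠ 0) : firstOp I n = 0 := if_neg hn

theorem secondOp_one : secondOp (1 : Smooth I) = Finsupp.single 1 1 := by
  simp [secondOp, fn]

theorem isDeformation_of_leading {q : Smooth I} {L : Ser (DiffOp I)} (h0 : L 0 = secondOp q)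
    (h : ∀ n : Fin 6, n ≠ 0 → ∀ j, L n j ≠ 0 → ∃ d : ℕ, d + j = (n : ℕ) + 1 ∧ HasDegree (L n j) d) :
    IsDeformation (secondOp q) L := by
  refine ⟨h0, fun n j hj => ?_⟩
  rcases eq_or_ne n 0 with rfl | hn
  · rw [h0, secondOp, Finsupp.add_apply] at hj ⊢
    rcases j with _ | _ | j
    · refine ⟨1, rfl, ?_⟩
      rw [Finsupp.single_eq_of_ne (by omega), Finsupp.single_eq_same, zero_add]
      exact (hasDegree_fn _).mul (hasDegree_jet 0)
    · refine ⟨0, rfl, ?_⟩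
      rw [Finsupp.single_eq_same, Finsupp.single_eq_of_ne (by omega), add_zero]
      exact hasDegree_fn _
    · rw [Finsupp.single_eq_of_ne (by omega), Finsupp.single_eq_of_ne (by omega)] at hj
      exact absurd (add_zero 0) hj
  · exact h n hn j hj

theorem isDeformation_firstOp : IsDeformation (secondOp 1) (firstOp I) :=
  isDeformation_of_leading secondOp_one.symm fun n hn j hj => by
    rw [firstOp_apply_of_ne hn] at hj
    exact absurd rfl hj

theorem fn_smul (r : ℝ) (f : Smooth I) : fn (r • f) = r • fn f := by
  rw [Algebra.smul_def, Algebra.smul_def, fn, map_mul]; rfl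

theorem fn_add (f g : Smooth I) : fn (f + g) = fn f + fn g := map_add _ f g

theorem fn_mul (f g : Smooth I) : fn (f * g) = fn f * fn g := map_mul _ f g

theorem fn_algebraMap (r : ℝ) : fn (algebraMap ℝ (Smooth I) r) = r • 1 :=
  Algebra.algebraMap_eq_smul_one r

theorem HasDegree.smul {F : DiffPoly I} {d : ℕ} (h : HasDegree F d) (r : ℝ) :
    HasDegree (r • F) d := by
  rw [Algebra.smul_def]
  exact h.C_mul (algebraMap ℝ (Smooth I) r)

theorem secondOp_smul_add (a b : ℝ) (q : Smooth I) :
    secondOp (a • q + algebraMap ℝ _ b) = a • secondOp q + b • Finsupp.single 1 1 := by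
  rw [secondOp, secondOp, Smooth.der_add, Smooth.der_smul, Smooth.der_algebraMap, add_zero,
    smul_comm, fn_smul, fn_add, fn_smul, fn_algebraMap, smul_mul_assoc, Finsupp.single_add,
    smul_add, Finsupp.smul_single, Finsupp.smul_single, Finsupp.smul_single]
  abel

theorem IsDeformation.smul_add {q : Smooth I} {L : Ser (DiffOp I)}
    (h : IsDeformation (secondOp q) L) (a b : ℝ) :
    IsDeformation (secondOp (a • q + algebraMap ℝ _ b)) (a • L + b • firstOp I) := by
  refine isDeformation_of_leading ?_ fun n hn j hj => ?_
  · rw [secondOp_smul_add, ← h.leading, ← firstOp_apply_zero]; rfl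
  · have hE : (a • L + b • firstOp I) n = a • L n := by
      rw [Pi.add_apply, Pi.smul_apply, Pi.smul_apply, firstOp_apply_of_ne hn, smul_zero, add_zero]
    rw [hE, Finsupp.smul_apply] at hj ⊢
    obtain ⟨d, hd, hdeg⟩ := h.graded n j fun h0 => hj (by rw [h0, smul_zero])
    exact ⟨d, hd, hdeg.smul a⟩

theorem bracket_smul_add (a b : ℝ) (L M : Ser (DiffOp I)) (F G : Ser (DiffPoly I)) :
    bracket (a • L + b • M) F G = a • bracket L F G + b • bracket M F G := by
  funext n
  rw [Pi.add_apply, Pi.smul_apply, Pi.smul_apply, bracket_apply, bracket_apply, bracket_apply,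
    Finset.smul_sum, Finset.smul_sum, ← Finset.sum_add_distrib]
  refine Finset.sum_congr rfl fun y _ => ?_
  split_ifs
  · rw [Pi.add_apply, Pi.smul_apply, Pi.smul_apply, act_add_left, act_smul_left, act_smul_left,
      mul_add, mul_smul_comm, mul_smul_comm]
  · simp

theorem IsNull.smul_add {F G : Ser (DiffPoly I)} (hF : IsNull F) (hG : IsNull G) (a b : ℝ) :
    IsNull (a • F + b • G) := by
  rw [isNull_iff] at *
  intro n
  rw [Pi.add_apply, Pi.smul_apply, Pi.smul_apply, map_add, map_smul, map_smul, hF, hG]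
  simp

section Commuting

variable {q : Smooth I} {L : Ser (DiffOp I)} {H : Smooth I → Ser (DiffPoly I)}

theorem field_mem_degGE {A : DiffOp I} (hL : IsDeformation A L) {G : Ser (DiffPoly I)}
    (hG : ∀ i : Fin 6, varD (G i) ∈ degGE (i : ℕ)) (n : Fin 6) : field L G n ∈ degGE (n + 1) := by
  rw [field_apply]
  refine sum_mem fun z _ => ?_
  split_ifs with h
  · exact (hL.opDeg _).act_mem (by omega) (hG _)
  · exact zero_mem _

/-- Flows of commuting Hamiltonians that agree at the leading order are equal. -/
theorem field_eq_of_commute (hI : IsConnected (I : Set ℝ)) {A B : DiffOp I}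
    {L M : Ser (DiffOp I)} (hL : IsDeformation A L) (hM : IsDeformation B M)
    (hH : ∀ f, H f 0 = fn f) (hdeg : ∀ f (i : Fin 6), varD (H f i) ∈ degGE (i : ℕ)) {f g : Smooth I}
    (hLf : ∀ h, IsNull (bracket L (H h) (H f))) (hMg : ∀ h, IsNull (bracket M (H h) (H g)))
    (h0 : A.act (fn (der f)) = B.act (fn (der g))) :
    field L (H f) = field M (H g) := by
  have key : ∀ n (hn : n < 6), field L (H f) ⟨n, hn⟩ - field M (H g) ⟨n, hn⟩ = 0 := by
    intro n hn
    induction n using Nat.strong_induction_on with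
    | _ n ih =>
    rcases Nat.eq_zero_or_pos n with rfl | hpos
    · have h1 := field_sub_of_eq (L := L) (M := 0) (n := 0) (by simp) (H f)
      have h2 := field_sub_of_eq (L := M) (M := 0) (n := 0) (by simp) (H g)
      have h3 : ∀ G, field (0 : Ser (DiffOp I)) G 0 = 0 := fun G => by
        rw [field_apply]
        exact Finset.sum_eq_zero fun z _ => by simp [act_zero_left]
      rw [h3, sub_zero, hH, varD_fn, Pi.zero_apply, sub_zero] at h1 h2
      rw [show (⟨0, hn⟩ : Fin 6) = 0 from rfl, h1, h2, hL.leading, hM.leading, h0, sub_self]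
    -- The difference has degree `n + 1`, which is at least two because `n > 0`. Order zero is out
    -- of reach of this test and is supplied by `h0`.
    refine eq_zero_of_loc_fn_mul (sub_mem ?_ ?_) fun h' => ?_
    · exact degGE_anti (by simp; omega) (field_mem_degGE hL (hdeg f) ⟨n, hn⟩)
    · exact degGE_anti (by simp; omega) (field_mem_degGE hM (hdeg g) ⟨n, hn⟩)
    obtain ⟨h, rfl⟩ := Smooth.exists_der_eq hI h'
    have e1 := isNull_iff.1 (hLf h) ⟨n, hn⟩
    have e2 := isNull_iff.1 (hMg h) ⟨n, hn⟩
    have e3 : ∀ (L : Ser (DiffOp I)) G, bracket L (H h) G ⟨n, hn⟩ = ∑ z : Fin 6 × Fin 6,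
        if (z.1 : ℕ) + (z.2 : ℕ) = n then varD (H h z.1) * field L G z.2 else 0 := fun L G => by
      rw [Fintype.sum_prod_type]; rfl
    rw [← sub_eq_zero.2 (e1.trans e2.symm), e3, e3, ← map_sub, ← Finset.sum_sub_distrib,
      -- Lower orders of the two flows agree by induction, so subtracting the null brackets leaves
      -- only `h'` times the order `n` difference.
      Finset.sum_eq_single_of_mem (0, ⟨n, hn⟩) (Finset.mem_univ _)]
    · simp [hH, varD_fn, mul_sub]
    · rintro ⟨i, j⟩ - hne
      split_ifs with hij
      · simp only at hij ⊢
        have hj : (j : ℕ) < n := by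
          by_contra hj
          refine hne ?_
          simp only [Prod.mk.injEq, Fin.ext_iff, Fin.val_zero]
          omega
        rw [← mul_sub, ih j hj j.2, mul_zero]
      · rw [sub_self]
  funext n
  exact sub_eq_zero.1 (key n n.2)

theorem secondOp_act_eq {f g : Smooth I}
    (h : ∀ u, der (der f) u = q u * der (der g) u + 1 / 2 * der q u * der g u) :
    (secondOp 1).act (fn (der f)) = (secondOp q).act (fn (der g)) := by
  have h' : der (der f) = q * der (der g) + (1 / 2 : ℝ) • der q * der g :=
    Smooth.ext fun u => by simp [h u, mul_assoc]
  rw [secondOp_one, act_single, secondOp_act, dx_fn, pow_one, dx_fn, h']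
  simp only [fn, map_add, map_mul]
  ring

theorem exists_der_der_eq (hI : IsConnected (I : Set ℝ)) (q g : Smooth I) : ∃ f : Smooth I,
    ∀ u, der (der f) u = q u * der (der g) u + 1 / 2 * der q u * der g u := by
  obtain ⟨k, hk⟩ := Smooth.exists_der_eq hI (q * der (der g) + (1 / 2 : ℝ) • der q * der g)
  obtain ⟨f, hf⟩ := Smooth.exists_der_eq hI k
  exact ⟨f, fun u => by rw [hf, hk]; simp [mul_assoc]⟩

/-- Once the lower orders of the operators agree, the order `n` flows differ by `(L n - M n) g'`,
and `g'` is arbitrary. -/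
theorem eq_of_field_eq (hI : IsConnected (I : Set ℝ)) {L M : Ser (DiffOp I)}
    (hH : ∀ f, H f 0 = fn f) {N : ℕ}
    (h : ∀ g (n : Fin 6), (n : ℕ) < N → field L (H g) n = field M (H g) n) (n : Fin 6)
    (hn : (n : ℕ) < N) : L n = M n := by
  obtain ⟨n, hn6⟩ := n
  induction n using Nat.strong_induction_on with
  | _ n ih =>
  refine sub_eq_zero.1 (diffOp_eq_zero fun g' => ?_)
  obtain ⟨g, rfl⟩ := Smooth.exists_der_eq hI g'
  have hf := field_sub_of_eq (L := L) (M := M) (n := ⟨n, hn6⟩)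
    (fun k hk => ih k hk k.2 (lt_trans (Fin.lt_def.1 hk) hn)) (H g)
  rw [h g _ hn, sub_self, hH, varD_fn] at hf
  exact hf.symm

/-- A deformation of the second bracket is determined by the commuting Hamiltonians. -/
theorem deformation_unique (hI : IsConnected (I : Set ℝ)) {L M : Ser (DiffOp I)}
    (hL : IsDeformation (secondOp q) L) (hM : IsDeformation (secondOp q) M)
    (hH : ∀ f, H f 0 = fn f) (hdeg : ∀ f (i : Fin 6), varD (H f i) ∈ degGE (i : ℕ))
    (hLc : ∀ f g, IsNull (bracket L (H f) (H g))) (hMc : ∀ f g, IsNull (bracket M (H f) (H g))) :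
    L = M := by
  funext n
  refine eq_of_field_eq hI hH (N := 6) (fun g n _ => ?_) n n.2
  rw [field_eq_of_commute hI hL hM hH hdeg (fun h => hLc h g) (fun h => hMc h g) rfl]

end Commuting

/-! ### Gradients of the Hamiltonians -/

/-- Evaluation of a differential polynomial at a jet. -/
def evalJet (u : I) (x : ℕ → ℝ) : DiffPoly I →+* ℝ := (MvPolynomial.eval x).comp (atPoint u)

@[simp] theorem evalJet_fn (u : I) (x : ℕ → ℝ) (f : Smooth I) : evalJet u x (fn f) = f u := by
  rw [evalJet, RingHom.comp_apply, atPoint_fn, MvPolynomial.eval_C]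

@[simp] theorem evalJet_jet (u : I) (x : ℕ → ℝ) (n : ℕ) : evalJet u x (jet n) = x n := by
  rw [evalJet, RingHom.comp_apply, atPoint_jet, MvPolynomial.eval_X]

@[simp] theorem evalJet_smul (u : I) (x : ℕ → ℝ) (r : ℝ) (F : DiffPoly I) :
    evalJet u x (r • F) = r * evalJet u x F := by
  rw [Algebra.smul_def, map_mul, ← mul_one (algebraMap _ _ _), ← Algebra.smul_def,
    ← fn_algebraMap, evalJet_fn, Smooth.algebraMap_apply]

/-- Polynomials over the infinite field `ℝ` are determined by their values. Identities of
differential polynomials thereby become identities of real numbers. -/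
theorem ext_evalJet {F G : DiffPoly I} (h : ∀ u x, evalJet u x F = evalJet u x G) : F = G :=
  ext_atPoint fun u => MvPolynomial.funext (h u)

/-- The variational derivative of `-a u_x²`. -/
def del2 (a : Smooth I) : DiffPoly I := fn (der a) * jet 0 ^ 2 + (2 : ℝ) • (fn a * jet 1)

/-- The variational derivative of `P u_xx² - R u_x⁴`. -/
def del4 (P R : Smooth I) : DiffPoly I :=
  fn (der P) * ((3 : ℝ) • jet 1 ^ 2 + (4 : ℝ) • (jet 0 * jet 2)) + (2 : ℝ) • (fn P * jet 3)
    + (2 : ℝ) • (fn (der (der P)) * (jet 0 ^ 2 * jet 1))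
    + (3 : ℝ) • (fn (der R) * jet 0 ^ 4) + (12 : ℝ) • (fn R * (jet 0 ^ 2 * jet 1))

theorem vars_fn_mul_jet_pow (f : Smooth I) (n k : ℕ) :
    (fn f * jet n ^ k : DiffPoly I).vars ⊆ {n} := by
  intro i hi
  by_contra hn
  refine notMem_vars_of_pderiv_eq_zero ?_ hi
  rw [Derivation.leibniz, Derivation.leibniz_pow, pderiv_fn, pderiv_jet,
    if_neg fun h => hn (Finset.mem_singleton.2 h.symm)]
  simp

theorem varD_fn_mul_jet_pow (f : Smooth I) (n k : ℕ) : varD (fn f * jet n ^ k) =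
    fn (der f) * jet n ^ k + (k : ℝ) • ((-dx) ^ (n + 1)) (fn f * jet n ^ (k - 1)) := by
  rw [varD_eq (vars_fn_mul_jet_pow _ _ _), Finset.sum_singleton, ← partialUD_apply,
    Derivation.leibniz, Derivation.leibniz_pow, Derivation.leibniz, Derivation.leibniz_pow,
    pderiv_fn, pderiv_jet, if_pos rfl, partialUD_apply, partialUD_apply, partialU_fn, partialU_jet,
    ← map_smul]
  refine congrArg₂ (· + ·) ?_ (congrArg _ ?_)
  · simp only [smul_eq_mul, smul_zero, mul_zero, zero_add, mul_comm]
  · simp only [smul_eq_mul, mul_zero, add_zero, mul_one, nsmul_eq_mul]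
    rw [Algebra.smul_def, map_natCast, mul_left_comm]

theorem dx_smul (r : ℝ) (F : DiffPoly I) : dx (r • F) = r • dx F := map_smul dx r F

theorem varD_neg (F : DiffPoly I) : varD (-F) = -varD F := by
  refine eq_neg_of_add_eq_zero_left ?_
  rw [← varD_add, neg_add_cancel, varD_zero]

theorem varD_quadratic (a : Smooth I) : varD (-fn a * jet 0 ^ 2) = del2 a := by
  rw [neg_mul, varD_neg, varD_fn_mul_jet_pow]
  refine ext_evalJet fun u x => ?_
  simp [del2, dx_mul]
  ring

theorem varD_quartic (P R : Smooth I) : varD (fn P * jet 1 ^ 2 - fn R * jet 0 ^ 4) = del4 P R := by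
  rw [sub_eq_add_neg, varD_add, varD_neg, varD_fn_mul_jet_pow, varD_fn_mul_jet_pow]
  refine ext_evalJet fun u x => ?_
  simp [del4, dx_mul, pow_succ]
  ring

theorem HasDegree.add {F G : DiffPoly I} {d : ℕ} (hF : HasDegree F d) (hG : HasDegree G d) :
    HasDegree (F + G) d := MvPolynomial.IsWeightedHomogeneous.add hF hG

theorem HasDegree.mul {F G : DiffPoly I} {d e : ℕ} (hF : HasDegree F d) (hG : HasDegree G e) :
    HasDegree (F * G) (d + e) := MvPolynomial.IsWeightedHomogeneous.mul hF hG

theorem HasDegree.pow {F : DiffPoly I} {d : ℕ} (hF : HasDegree F d) (k : ℕ) :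
    HasDegree (F ^ k) (k * d) := by
  have h := MvPolynomial.IsWeightedHomogeneous.pow hF k
  rw [smul_eq_mul] at h
  exact h

theorem HasDegree.fn_mul {F : DiffPoly I} {d : ℕ} (hF : HasDegree F d) (f : Smooth I) :
    HasDegree (fn f * F) d := MvPolynomial.IsWeightedHomogeneous.C_mul hF f

theorem del2_mem_degGE (a : Smooth I) : del2 a ∈ degGE 2 :=
  HasDegree.mem_degGE ((((hasDegree_jet 0).pow 2).fn_mul _).add
    (((hasDegree_jet 1).fn_mul _).smul 2))

theorem del4_mem_degGE (P R : Smooth I) : del4 P R ∈ degGE 4 := by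
  have h2 : HasDegree (jet 0 ^ 2 * jet 1 : DiffPoly I) 4 :=
    ((hasDegree_jet 0).pow 2).mul (hasDegree_jet 1)
  have h3 : HasDegree ((3 : ℝ) • jet 1 ^ 2 + (4 : ℝ) • (jet 0 * jet 2) : DiffPoly I) 4 :=
    (((hasDegree_jet 1).pow 2).smul 3).add (((hasDegree_jet 0).mul (hasDegree_jet 2)).smul 4)
  exact HasDegree.mem_degGE (((((h3.fn_mul _).add (((hasDegree_jet 3).fn_mul _).smul 2)).add
    ((h2.fn_mul _).smul 2)).add ((((hasDegree_jet 0).pow 4).fn_mul _).smul 3)).add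
    ((h2.fn_mul _).smul 12))

/-- The coefficient of `-ε² u_x²` in `h_f`, in terms of the third derivative `t` of `f`. -/
def hamA (c t : Smooth I) : Smooth I := (1 / 24 : ℝ) • (c * t)

/-- The coefficient of `ε⁴ u_xx²` in `h_f`, in terms of the third derivative `t` of `f`. -/
def hamP (c p t : Smooth I) : Smooth I := p * t + (1 / 480 : ℝ) • (c ^ 2 * der t)

/-- The coefficient of `-ε⁴ u_x⁴` in `h_f`, in terms of the third derivative `t` of `f`. -/
def hamR (c p s t : Smooth I) : Smooth I :=
  (1 / 1152 : ℝ) • (der (der c) * c * der t) + (1 / 1152 : ℝ) • (c * der c * der (der t))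
    + (1 / 3456 : ℝ) • (c ^ 2 * der (der (der t))) + (1 / 6 : ℝ) • (der p * der t)
    + (1 / 6 : ℝ) • (p * der (der t)) - s * t

theorem varD_ham (c p s f : Smooth I) (i : Fin 6) : varD (ham c p s f i) =
    (![fn (der f), 0, del2 (hamA c (der (der (der f)))), 0,
      del4 (hamP c p (der (der (der f)))) (hamR c p s (der (der (der f)))), 0] :
      Ser (DiffPoly I)) i := by
  fin_cases i
  · exact varD_fn f
  · exact varD_zero
  · exact varD_quadratic _
  · exact varD_zero
  · rw [hamR, mul_comm (der (der c))]
    exact varD_quartic _ _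
  · exact varD_zero

theorem varD_ham_mem_degGE (c p s f : Smooth I) (i : Fin 6) :
    varD (ham c p s f i) ∈ degGE (i : ℕ) := by
  rw [varD_ham]
  fin_cases i
  · exact mem_degGE_zero _
  · exact zero_mem _
  · exact del2_mem_degGE _
  · exact zero_mem _
  · exact del4_mem_degGE _ _
  · exact zero_mem _

/-! ### Commutation under the first bracket -/

theorem field_firstOp (G : Ser (DiffPoly I)) (n : Fin 6) :
    field (firstOp I) G n = dx (varD (G n)) := by
  rw [field_apply, Finset.sum_eq_single_of_mem (0, n) (Finset.mem_univ _)]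
  · rw [if_pos (by simp), firstOp_apply_zero, act_single, pow_one, one_mul]
  · rintro ⟨k, j⟩ - hne
    split_ifs with h
    · have hk : k ≠ 0 := by
        rintro rfl
        exact hne (by simp only [Prod.mk.injEq, Fin.ext_iff, true_and]; simpa using h)
      rw [firstOp_apply_of_ne hk, act_zero_left]
    · rfl

theorem bracket_firstOp_ham (c p s f g : Smooth I) (n : Fin 6) :
    bracket (firstOp I) (ham c p s f) (ham c p s g) n =
    (![fn (der f) * dx (fn (der g)), 0, fn (der f) * dx (varD (ham c p s g 2)) +
      varD (ham c p s f 2) * dx (fn (der g)), 0, fn (der f) * dx (varD (ham c p s g 4)) +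
      varD (ham c p s f 2) * dx (varD (ham c p s g 2)) + varD (ham c p s f 4) * dx (fn (der g)), 0] :
      Ser (DiffPoly I)) n := by
  have h : bracket (firstOp I) (ham c p s f) (ham c p s g) n = ∑ i : Fin 6, ∑ j : Fin 6,
      if (i : ℕ) + (j : ℕ) = n then varD (ham c p s f i) * dx (varD (ham c p s g j)) else 0 := by
    simp only [← field_firstOp]; rfl
  have h0 : ∀ f, varD (ham c p s f 0) = fn (der f) := fun f => varD_ham c p s f 0
  have h1 : ∀ f, varD (ham c p s f 1) = 0 := fun f => varD_ham c p s f 1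
  have h3 : ∀ f, varD (ham c p s f 3) = 0 := fun f => varD_ham c p s f 3
  have h5 : ∀ f, varD (ham c p s f 5) = 0 := fun f => varD_ham c p s f 5
  rw [h]
  simp only [Fin.sum_univ_six, h0, h1, h3, h5, zero_mul, map_zero, mul_zero, ite_self, add_zero]
  fin_cases n <;> simp

/-- This is the first variation of `-a u_x²` along `X`, with a lower-order integrand than the
gradient itself; `loc_del4_mul` does the same for the quartic density. -/
theorem loc_del2_mul (a : Smooth I) (X : DiffPoly I) : loc (del2 a * X) =
    -loc (fn (der a) * jet 0 ^ 2 * X + (2 : ℝ) • (fn a * jet 0 * dx X)) := by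
  rw [eq_neg_iff_add_eq_zero, ← map_add, ← loc_dx ((2 : ℝ) • (fn a * jet 0 * X))]
  congr 1
  refine ext_evalJet fun u x => ?_
  simp only [del2, dx_mul, dx_smul, dx_fn, dx_jet, map_add, map_mul, map_pow, evalJet_fn,
    evalJet_jet, evalJet_smul]
  ring

theorem loc_del4_mul (P R : Smooth I) (X : DiffPoly I) : loc (del4 P R * X) =
    loc (fn (der P) * jet 1 ^ 2 * X + (2 : ℝ) • (fn P * jet 1 * dx (dx X))
      - (fn (der R) * jet 0 ^ 4 * X + (4 : ℝ) • (fn R * jet 0 ^ 3 * dx X))) := by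
  -- These are the boundary terms: two integrations by parts for `P u_xx²`, one for `R u_x⁴`.
  rw [← sub_eq_zero, ← map_sub, ← loc_dx (X * dx ((2 : ℝ) • (fn P * jet 1))
    - dx X * ((2 : ℝ) • (fn P * jet 1)) + (4 : ℝ) • (fn R * (jet 0 * (jet 0 * jet 0)) * X))]
  congr 1
  refine ext_evalJet fun u x => ?_
  simp only [del4, dx_mul, dx_smul, dx_fn, dx_jet, map_add, map_sub, map_mul, map_pow, evalJet_fn,
    evalJet_jet, evalJet_smul]
  ring

theorem loc_mul_dx_add_mul_dx (a b X Y : DiffPoly I) :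
    loc (a * dx X + Y * dx b) = loc (Y * dx b) - loc (X * dx a) := by
  rw [map_add, loc_mul_dx, mul_comm X]; abel

theorem commute_second_order (c f g : Smooth I) :
    loc (fn (der f) * dx (del2 (hamA c (der (der (der g)))))
      + del2 (hamA c (der (der (der f)))) * dx (fn (der g))) = 0 := by
  rw [loc_mul_dx_add_mul_dx, loc_del2_mul, loc_del2_mul, ← map_neg, ← map_neg, ← map_sub,
    ← loc_dx (fn ((1 / 24 : ℝ) • (c * (der (der f)) * (der (der (der g))))
      + (-1 / 24 : ℝ) • (c * (der (der (der f))) * (der (der g)))) * (jet 0 * jet 0))]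
  congr 1
  refine ext_evalJet fun u x => ?_
  simp only [hamA, dx_mul, dx_fn, dx_jet, map_add, map_sub, map_neg, map_mul, evalJet_fn,
    evalJet_jet, evalJet_smul, pow_succ, pow_zero, one_mul, Smooth.der_add, Smooth.der_mul,
    Smooth.der_smul, Smooth.add_apply, Smooth.mul_apply, Smooth.smul_apply]
  ring

theorem commute_fourth_order (c p s f g : Smooth I) :
    loc (fn (der f) * dx (del4 (hamP c p (der (der (der g)))) (hamR c p s (der (der (der g)))))
      + del2 (hamA c (der (der (der f)))) * dx (del2 (hamA c (der (der (der g)))))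
      + del4 (hamP c p (der (der (der f)))) (hamR c p s (der (der (der f)))) * dx (fn (der g)))
      = 0 := by
  -- The density has degree five, so its primitive has degree four. The one given combines `u_x²
  -- u_xx`, `u_x⁴` and `u_xx²` with coefficients depending on `u`.
  rw [add_right_comm, map_add, loc_mul_dx_add_mul_dx, loc_del4_mul, loc_del4_mul, ← map_sub,
    ← map_add, ← loc_dx (fn ((1 / 288 : ℝ) • (c * (der c) * (der (der (der f))) * (der (der (der g))))
      + (1 / 288 : ℝ) • (c ^ 2 * (der (der (der (der f)))) * (der (der (der g))))) * (jet 0 * jet 0 * jet 1)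
    + fn ((1 / 1152 : ℝ) • (c * (der c) * (der (der f)) * (der (der (der (der (der g))))))
      + (1 / 384 : ℝ) • (c * (der c) * (der (der (der f))) * (der (der (der (der g)))))
      + (-1 / 1152 : ℝ) • (c * (der c) * (der (der (der (der f)))) * (der (der (der g))))
      + (-1 / 1152 : ℝ) • (c * (der c) * (der (der (der (der (der f))))) * (der (der g)))
      + (1 / 1152 : ℝ) • (c * (der (der c)) * (der (der f)) * (der (der (der (der g)))))
      + (-1 / 1152 : ℝ) • (c * (der (der c)) * (der (der (der (der f)))) * (der (der g)))
      + (1 / 3456 : ℝ) • (c ^ 2 * (der (der f)) * (der (der (der (der (der (der g)))))))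
      + (1 / 1152 : ℝ) • (c ^ 2 * (der (der (der f))) * (der (der (der (der (der g))))))
      + (1 / 1152 : ℝ) • (c ^ 2 * (der (der (der (der f)))) * (der (der (der (der g)))))
      + (-1 / 1152 : ℝ) • (c ^ 2 * (der (der (der (der (der f))))) * (der (der (der g))))
      + (-1 / 3456 : ℝ) • (c ^ 2 * (der (der (der (der (der (der f)))))) * (der (der g)))
      + (1 / 1152 : ℝ) • ((der c) ^ 2 * (der (der (der f))) * (der (der (der g))))
      + (-1 : ℝ) • ((der (der f)) * (der (der (der g))) * s)
      + (1 / 6 : ℝ) • ((der (der f)) * (der (der (der (der g)))) * (der p))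
      + (1 / 6 : ℝ) • ((der (der f)) * (der (der (der (der (der g))))) * p)
      + (1 : ℝ) • ((der (der (der f))) * (der (der g)) * s)
      + (1 / 2 : ℝ) • ((der (der (der f))) * (der (der (der (der g)))) * p)
      + (-1 / 6 : ℝ) • ((der (der (der (der f)))) * (der (der g)) * (der p))
      + (-1 / 2 : ℝ) • ((der (der (der (der f)))) * (der (der (der g))) * p)
      + (-1 / 6 : ℝ) • ((der (der (der (der (der f))))) * (der (der g)) * p)) * (jet 0 * jet 0 * jet 0 * jet 0)
    + fn ((-1 / 480 : ℝ) • (c ^ 2 * (der (der f)) * (der (der (der (der g)))))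
      + (1 / 288 : ℝ) • (c ^ 2 * (der (der (der f))) * (der (der (der g))))
      + (1 / 480 : ℝ) • (c ^ 2 * (der (der (der (der f)))) * (der (der g)))
      + (-1 : ℝ) • ((der (der f)) * (der (der (der g))) * p)
      + (1 : ℝ) • ((der (der (der f))) * (der (der g)) * p)) * (jet 1 * jet 1))]
  congr 1
  refine ext_evalJet fun u x => ?_
  simp only [hamA, hamP, hamR, del2, dx_mul, dx_smul, dx_fn, dx_jet, map_add, map_sub, map_mul,
    evalJet_fn, evalJet_jet, evalJet_smul, pow_succ, pow_zero, one_mul,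
    Smooth.der_add, Smooth.der_sub, Smooth.der_mul, Smooth.der_smul, Smooth.add_apply,
    Smooth.sub_apply, Smooth.mul_apply, Smooth.smul_apply]
  ring

theorem commute_first_ham (hI : IsConnected (I : Set ℝ)) (c p s f g : Smooth I) :
    IsNull (bracket (firstOp I) (ham c p s f) (ham c p s g)) := by
  have h0 : loc (fn (der f) * dx (fn (der g))) = 0 := by
    obtain ⟨k, hk⟩ := Smooth.exists_der_eq hI (der f * der (der g))
    rw [dx_fn, ← mul_assoc, ← fn_mul, ← hk, ← dx_fn, loc_dx]
  have h2 : ∀ f, varD (ham c p s f 2) = del2 (hamA c (der (der (der f)))) :=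
    fun f => varD_ham c p s f 2
  have h4 : ∀ f, varD (ham c p s f 4) = del4 (hamP c p (der (der (der f))))
      (hamR c p s (der (der (der f)))) := fun f => varD_ham c p s f 4
  refine isNull_iff.2 fun n => ?_
  rw [bracket_firstOp_ham, h2, h2, h4, h4]
  have e2 := commute_second_order c f g
  have e4 := commute_fourth_order c p s f g
  generalize fn (der f) * dx (fn (der g)) = x0 at *
  generalize fn (der f) * dx (del2 (hamA c (der (der (der g)))))
      + del2 (hamA c (der (der (der f)))) * dx (fn (der g)) = x2 at *
  generalize fn (der f) * dx (del4 (hamP c p (der (der (der g)))) (hamR c p s (der (der (der g)))))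
      + del2 (hamA c (der (der (der f)))) * dx (del2 (hamA c (der (der (der g)))))
      + del4 (hamP c p (der (der (der f)))) (hamR c p s (der (der (der f)))) * dx (fn (der g))
      = x4 at *
  fin_cases n
  · exact h0
  · exact map_zero _
  · exact e2
  · exact map_zero _
  · exact e4
  · exact map_zero _

/-! ### The explicit second bracket -/

/-- The coefficients of the order `ε²` of the second bracket. -/
def opTwoCoeff (c q : Smooth I) : ℕ → DiffPoly I
  | 0 => fn ((1 / 12 : ℝ) • (c * (der (der (der q))))
        + (1 / 12 : ℝ) • ((der c) * (der (der q)))) * (jet 0 * jet 1)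
      + fn ((1 / 48 : ℝ) • (c * (der (der (der (der q)))))
        + (1 / 24 : ℝ) • ((der c) * (der (der (der q))))
        + (1 / 48 : ℝ) • ((der (der c)) * (der (der q)))) * (jet 0 ^ 3)
      + fn ((1 / 24 : ℝ) • (c * (der (der q)))) * (jet 2)
  | 1 => fn ((5 / 48 : ℝ) • (c * (der (der (der q))))
        + (1 / 6 : ℝ) • ((der c) * (der (der q)))
        + (1 / 16 : ℝ) • ((der (der c)) * (der q))) * (jet 0 ^ 2)
      + fn ((7 / 48 : ℝ) • (c * (der (der q)))
        + (1 / 16 : ℝ) • ((der c) * (der q))) * (jet 1)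
  | 2 => fn ((3 / 16 : ℝ) • (c * (der (der q)))
        + (3 / 16 : ℝ) • ((der c) * (der q))) * (jet 0)
  | 3 => fn ((1 / 8 : ℝ) • (c * (der q)))
  | _ => 0

theorem hasDegree_opTwoCoeff (c q : Smooth I) (j : ℕ) (h : opTwoCoeff c q j ≠ 0) :
    ∃ d, d + j = 3 ∧ HasDegree (opTwoCoeff c q j) d := by
  match j with
  | 0 => exact ⟨3, rfl, ((HasDegree.fn_mul ((((hasDegree_jet 0)).mul ((hasDegree_jet 1)))) _).add
        (HasDegree.fn_mul ((hasDegree_jet 0).pow 3) _)).add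
        (HasDegree.fn_mul ((hasDegree_jet 2)) _)⟩
  | 1 => exact ⟨2, rfl, (HasDegree.fn_mul ((hasDegree_jet 0).pow 2) _).add
        (HasDegree.fn_mul ((hasDegree_jet 1)) _)⟩
  | 2 => exact ⟨1, rfl, HasDegree.fn_mul ((hasDegree_jet 0)) _⟩
  | 3 => exact ⟨0, rfl, hasDegree_fn _⟩
  | j + 4 => exact absurd rfl h

/-- The coefficients of the order `ε⁴` of the second bracket. -/
def opFourCoeff (c p s q : Smooth I) : ℕ → DiffPoly I
  | 0 => fn ((19 / 480 : ℝ) • (c * (der c) * (der (der (der (der q)))))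
        + (1 / 40 : ℝ) • (c * (der (der c)) * (der (der (der q))))
        + (31 / 2880 : ℝ) • (c ^ 2 * (der (der (der (der (der q))))))
        + (7 / 480 : ℝ) • ((der c) ^ 2 * (der (der (der q))))
        + (11 / 2 : ℝ) • (p * (der (der (der (der q)))))
        + (9 : ℝ) • ((der p) * (der (der (der q))))
        + (7 / 2 : ℝ) • ((der (der p)) * (der (der q)))
        + (-12 : ℝ) • ((der (der q)) * s)) * (jet 0 * jet 1 ^ 2)
      + fn ((1 / 80 : ℝ) • (c * (der c) * (der (der (der q))))
        + (1 / 160 : ℝ) • (c ^ 2 * (der (der (der (der q)))))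
        + (3 : ℝ) • (p * (der (der (der q))))
        + (3 : ℝ) • ((der p) * (der (der q)))) * (jet 0 * jet 3)
      + fn ((29 / 960 : ℝ) • (c * (der c) * (der (der (der (der q)))))
        + (17 / 960 : ℝ) • (c * (der (der c)) * (der (der (der q))))
        + (23 / 2880 : ℝ) • (c ^ 2 * (der (der (der (der (der q))))))
        + (1 / 80 : ℝ) • ((der c) ^ 2 * (der (der (der q))))
        + (4 : ℝ) • (p * (der (der (der (der q)))))
        + (7 : ℝ) • ((der p) * (der (der (der q))))
        + (3 : ℝ) • ((der (der p)) * (der (der q)))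
        + (-6 : ℝ) • ((der (der q)) * s)) * (jet 0 ^ 2 * jet 2)
      + fn ((43 / 1440 : ℝ) • (c * (der c) * (der (der (der (der (der q))))))
        + (1 / 30 : ℝ) • (c * (der (der c)) * (der (der (der (der q)))))
        + (7 / 480 : ℝ) • (c * (der (der (der c))) * (der (der (der q))))
        + (1 / 180 : ℝ) • (c ^ 2 * (der (der (der (der (der (der q)))))))
        + (11 / 480 : ℝ) • ((der c) * (der (der c)) * (der (der (der q))))
        + (11 / 480 : ℝ) • ((der c) ^ 2 * (der (der (der (der q)))))
        + (3 : ℝ) • (p * (der (der (der (der (der q))))))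
        + (7 : ℝ) • ((der p) * (der (der (der (der q)))))
        + (5 : ℝ) • ((der (der p)) * (der (der (der q))))
        + (1 : ℝ) • ((der (der (der p))) * (der (der q)))
        + (-12 : ℝ) • ((der (der q)) * (der s))
        + (-12 : ℝ) • ((der (der (der q))) * s)) * (jet 0 ^ 3 * jet 1)
      + fn ((7 / 2304 : ℝ) • (c * (der c) * (der (der (der (der (der (der q)))))))
        + (11 / 2304 : ℝ) • (c * (der (der c)) * (der (der (der (der (der q))))))
        + (1 / 256 : ℝ) • (c * (der (der (der c))) * (der (der (der (der q)))))
        + (1 / 768 : ℝ) • (c * (der (der (der (der c)))) * (der (der (der q))))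
        + (1 / 2304 : ℝ) • (c ^ 2 * (der (der (der (der (der (der (der q))))))))
        + (5 / 768 : ℝ) • ((der c) * (der (der c)) * (der (der (der (der q)))))
        + (1 / 384 : ℝ) • ((der c) * (der (der (der c))) * (der (der (der q))))
        + (1 / 288 : ℝ) • ((der c) ^ 2 * (der (der (der (der (der q))))))
        + (1 / 768 : ℝ) • ((der (der c)) ^ 2 * (der (der (der q))))
        + (1 / 4 : ℝ) • (p * (der (der (der (der (der (der q)))))))
        + (3 / 4 : ℝ) • ((der p) * (der (der (der (der (der q))))))
        + (3 / 4 : ℝ) • ((der (der p)) * (der (der (der (der q)))))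
        + (1 / 4 : ℝ) • ((der (der (der p))) * (der (der (der q))))
        + (-3 / 2 : ℝ) • ((der (der q)) * (der (der s)))
        + (-3 : ℝ) • ((der (der (der q))) * (der s))
        + (-3 / 2 : ℝ) • ((der (der (der (der q)))) * s)) * (jet 0 ^ 5)
      + fn ((1 / 48 : ℝ) • (c * (der c) * (der (der (der q))))
        + (1 / 96 : ℝ) • (c ^ 2 * (der (der (der (der q)))))
        + (5 : ℝ) • (p * (der (der (der q))))
        + (5 : ℝ) • ((der p) * (der (der q)))) * (jet 1 * jet 2)
      + fn ((1 / 480 : ℝ) • (c ^ 2 * (der (der (der q))))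
        + (1 : ℝ) • (p * (der (der q)))) * (jet 4)
  | 1 => fn ((9 / 128 : ℝ) • (c * (der c) * (der (der (der q))))
        + (3 / 160 : ℝ) • (c * (der (der c)) * (der (der q)))
        + (-1 / 192 : ℝ) • (c * (der (der (der c))) * (der q))
        + (13 / 480 : ℝ) • (c ^ 2 * (der (der (der (der q)))))
        + (-1 / 64 : ℝ) • ((der c) * (der (der c)) * (der q))
        + (1 / 120 : ℝ) • ((der c) ^ 2 * (der (der q)))
        + (25 / 2 : ℝ) • (p * (der (der (der q))))
        + (16 : ℝ) • ((der p) * (der (der q)))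
        + (4 : ℝ) • ((der (der p)) * (der q))
        + (-9 : ℝ) • ((der q) * s)) * (jet 0 * jet 2)
      + fn ((229 / 1920 : ℝ) • (c * (der c) * (der (der (der (der q)))))
        + (5 / 48 : ℝ) • (c * (der (der c)) * (der (der (der q))))
        + (119 / 3840 : ℝ) • (c * (der (der (der c))) * (der (der q)))
        + (-1 / 768 : ℝ) • (c * (der (der (der (der c)))) * (der q))
        + (313 / 11520 : ℝ) • (c ^ 2 * (der (der (der (der (der q))))))
        + (157 / 3840 : ℝ) • ((der c) * (der (der c)) * (der (der q)))
        + (-1 / 192 : ℝ) • ((der c) * (der (der (der c))) * (der q))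
        + (13 / 192 : ℝ) • ((der c) ^ 2 * (der (der (der q))))
        + (-1 / 256 : ℝ) • ((der (der c)) ^ 2 * (der q))
        + (13 : ℝ) • (p * (der (der (der (der q)))))
        + (49 / 2 : ℝ) • ((der p) * (der (der (der q))))
        + (53 / 4 : ℝ) • ((der (der p)) * (der (der q)))
        + (7 / 4 : ℝ) • ((der (der (der p))) * (der q))
        + (-45 / 2 : ℝ) • ((der q) * (der s))
        + (-69 / 2 : ℝ) • ((der (der q)) * s)) * (jet 0 ^ 2 * jet 1)
      + fn ((49 / 2304 : ℝ) • (c * (der c) * (der (der (der (der (der q))))))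
        + (11 / 384 : ℝ) • (c * (der (der c)) * (der (der (der (der q)))))
        + (5 / 256 : ℝ) • (c * (der (der (der c))) * (der (der (der q))))
        + (1 / 192 : ℝ) • (c * (der (der (der (der c)))) * (der (der q)))
        + (1 / 288 : ℝ) • (c ^ 2 * (der (der (der (der (der (der q)))))))
        + (25 / 768 : ℝ) • ((der c) * (der (der c)) * (der (der (der q))))
        + (1 / 96 : ℝ) • ((der c) * (der (der (der c))) * (der (der q)))
        + (1 / 48 : ℝ) • ((der c) ^ 2 * (der (der (der (der q)))))
        + (1 / 192 : ℝ) • ((der (der c)) ^ 2 * (der (der q)))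
        + (7 / 4 : ℝ) • (p * (der (der (der (der (der q))))))
        + (9 / 2 : ℝ) • ((der p) * (der (der (der (der q)))))
        + (15 / 4 : ℝ) • ((der (der p)) * (der (der (der q))))
        + (1 : ℝ) • ((der (der (der p))) * (der (der q)))
        + (-9 / 2 : ℝ) • ((der q) * (der (der s)))
        + (-12 : ℝ) • ((der (der q)) * (der s))
        + (-15 / 2 : ℝ) • ((der (der (der q))) * s)) * (jet 0 ^ 4)
      + fn ((89 / 1920 : ℝ) • (c * (der c) * (der (der (der q))))
        + (3 / 160 : ℝ) • (c * (der (der c)) * (der (der q)))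
        + (17 / 960 : ℝ) • (c ^ 2 * (der (der (der (der q)))))
        + (1 / 120 : ℝ) • ((der c) ^ 2 * (der (der q)))
        + (8 : ℝ) • (p * (der (der (der q))))
        + (9 : ℝ) • ((der p) * (der (der q)))
        + (3 / 2 : ℝ) • ((der (der p)) * (der q))
        + (-9 : ℝ) • ((der q) * s)) * (jet 1 ^ 2)
      + fn ((17 / 3840 : ℝ) • (c * (der c) * (der (der q)))
        + (-5 / 768 : ℝ) • (c * (der (der c)) * (der q))
        + (3 / 256 : ℝ) • (c ^ 2 * (der (der (der q))))
        + (-5 / 768 : ℝ) • ((der c) ^ 2 * (der q))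
        + (23 / 4 : ℝ) • (p * (der (der q)))
        + (11 / 4 : ℝ) • ((der p) * (der q))) * (jet 3)
  | 2 => fn ((97 / 640 : ℝ) • (c * (der c) * (der (der (der q))))
        + (13 / 160 : ℝ) • (c * (der (der c)) * (der (der q)))
        + (3 / 64 : ℝ) • (c ^ 2 * (der (der (der (der q)))))
        + (1 / 20 : ℝ) • ((der c) ^ 2 * (der (der q)))
        + (39 / 2 : ℝ) • (p * (der (der (der q))))
        + (27 : ℝ) • ((der p) * (der (der q)))
        + (9 : ℝ) • ((der (der p)) * (der q))
        + (-27 : ℝ) • ((der q) * s)) * (jet 0 * jet 1)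
      + fn ((23 / 384 : ℝ) • (c * (der c) * (der (der (der (der q)))))
        + (1 / 16 : ℝ) • (c * (der (der c)) * (der (der (der q))))
        + (7 / 256 : ℝ) • (c * (der (der (der c))) * (der (der q)))
        + (1 / 768 : ℝ) • (c * (der (der (der (der c)))) * (der q))
        + (3 / 256 : ℝ) • (c ^ 2 * (der (der (der (der (der q))))))
        + (13 / 256 : ℝ) • ((der c) * (der (der c)) * (der (der q)))
        + (1 / 192 : ℝ) • ((der c) * (der (der (der c))) * (der q))
        + (3 / 64 : ℝ) • ((der c) ^ 2 * (der (der (der q))))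
        + (1 / 256 : ℝ) • ((der (der c)) ^ 2 * (der q))
        + (5 : ℝ) • (p * (der (der (der (der q)))))
        + (21 / 2 : ℝ) • ((der p) * (der (der (der q))))
        + (27 / 4 : ℝ) • ((der (der p)) * (der (der q)))
        + (5 / 4 : ℝ) • ((der (der (der p))) * (der q))
        + (-27 / 2 : ℝ) • ((der q) * (der s))
        + (-27 / 2 : ℝ) • ((der (der q)) * s)) * (jet 0 ^ 3)
      + fn ((13 / 480 : ℝ) • (c * (der c) * (der (der q)))
        + (-1 / 96 : ℝ) • (c * (der (der c)) * (der q))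
        + (1 / 40 : ℝ) • (c ^ 2 * (der (der (der q))))
        + (-1 / 96 : ℝ) • ((der c) ^ 2 * (der q))
        + (11 : ℝ) • (p * (der (der q)))
        + (8 : ℝ) • ((der p) * (der q))) * (jet 2)
  | 3 => fn ((31 / 384 : ℝ) • (c * (der c) * (der (der (der q))))
        + (5 / 96 : ℝ) • (c * (der (der c)) * (der (der q)))
        + (1 / 192 : ℝ) • (c * (der (der (der c))) * (der q))
        + (1 / 48 : ℝ) • (c ^ 2 * (der (der (der (der q)))))
        + (1 / 64 : ℝ) • ((der c) * (der (der c)) * (der q))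
        + (1 / 24 : ℝ) • ((der c) ^ 2 * (der (der q)))
        + (15 / 2 : ℝ) • (p * (der (der (der q))))
        + (12 : ℝ) • ((der p) * (der (der q)))
        + (5 : ℝ) • ((der (der p)) * (der q))
        + (-9 : ℝ) • ((der q) * s)) * (jet 0 ^ 2)
      + fn ((33 / 640 : ℝ) • (c * (der c) * (der (der q)))
        + (1 / 384 : ℝ) • (c * (der (der c)) * (der q))
        + (11 / 384 : ℝ) • (c ^ 2 * (der (der (der q))))
        + (1 / 384 : ℝ) • ((der c) ^ 2 * (der q))
        + (21 / 2 : ℝ) • (p * (der (der q)))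
        + (17 / 2 : ℝ) • ((der p) * (der q))) * (jet 1)
  | 4 => fn ((35 / 768 : ℝ) • (c * (der c) * (der (der q)))
        + (5 / 768 : ℝ) • (c * (der (der c)) * (der q))
        + (5 / 256 : ℝ) • (c ^ 2 * (der (der (der q))))
        + (5 / 768 : ℝ) • ((der c) ^ 2 * (der q))
        + (25 / 4 : ℝ) • (p * (der (der q)))
        + (25 / 4 : ℝ) • ((der p) * (der q))) * (jet 0)
  | 5 => fn ((1 / 384 : ℝ) • (c * (der c) * (der q))
        + (1 / 128 : ℝ) • (c ^ 2 * (der (der q)))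
        + (5 / 2 : ℝ) • (p * (der q)))
  | _ => 0

theorem hasDegree_opFourCoeff (c p s q : Smooth I) (j : ℕ) (h : opFourCoeff c p s q j ≠ 0) :
    ∃ d, d + j = 5 ∧ HasDegree (opFourCoeff c p s q j) d := by
  match j with
  | 0 => exact ⟨5, rfl, ((((((HasDegree.fn_mul ((((hasDegree_jet 0)).mul ((hasDegree_jet 1).pow 2))) _).add
        (HasDegree.fn_mul ((((hasDegree_jet 0)).mul ((hasDegree_jet 3)))) _)).add
        (HasDegree.fn_mul ((((hasDegree_jet 0).pow 2).mul ((hasDegree_jet 2)))) _)).add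
        (HasDegree.fn_mul ((((hasDegree_jet 0).pow 3).mul ((hasDegree_jet 1)))) _)).add
        (HasDegree.fn_mul ((hasDegree_jet 0).pow 5) _)).add
        (HasDegree.fn_mul ((((hasDegree_jet 1)).mul ((hasDegree_jet 2)))) _)).add
        (HasDegree.fn_mul ((hasDegree_jet 4)) _)⟩
  | 1 => exact ⟨4, rfl, ((((HasDegree.fn_mul ((((hasDegree_jet 0)).mul ((hasDegree_jet 2)))) _).add
        (HasDegree.fn_mul ((((hasDegree_jet 0).pow 2).mul ((hasDegree_jet 1)))) _)).add
        (HasDegree.fn_mul ((hasDegree_jet 0).pow 4) _)).add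
        (HasDegree.fn_mul ((hasDegree_jet 1).pow 2) _)).add
        (HasDegree.fn_mul ((hasDegree_jet 3)) _)⟩
  | 2 => exact ⟨3, rfl, ((HasDegree.fn_mul ((((hasDegree_jet 0)).mul ((hasDegree_jet 1)))) _).add
        (HasDegree.fn_mul ((hasDegree_jet 0).pow 3) _)).add
        (HasDegree.fn_mul ((hasDegree_jet 2)) _)⟩
  | 3 => exact ⟨2, rfl, (HasDegree.fn_mul ((hasDegree_jet 0).pow 2) _).add
        (HasDegree.fn_mul ((hasDegree_jet 1)) _)⟩
  | 4 => exact ⟨1, rfl, HasDegree.fn_mul ((hasDegree_jet 0)) _⟩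
  | 5 => exact ⟨0, rfl, hasDegree_fn _⟩
  | j + 6 => exact absurd rfl h

/-! ### The recursion relation and its defect -/

/-- The right-hand side `q g' + ½ q' g` of the recursion relation for the gradients. -/
def recursionRHS (q g : Smooth I) : Smooth I :=
  (1 : ℝ) • (q * (der g))
    + (1 / 2 : ℝ) • ((der q) * g)

theorem dx_pow_2_fn (f : Smooth I) : (dx ^ 2) (fn f) =
    fn (der f) * ((1 : ℝ) • (jet 1))
    + fn (der (der f)) * ((1 : ℝ) • (jet 0 ^ 2)) := by
  rw [dx_pow_succ, pow_one, dx_fn]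
  refine ext_evalJet fun u x => ?_
  simp only [pow_succ, pow_zero, one_mul, dx_mul, dx_fn, dx_jet, map_add, map_mul,
    evalJet_fn, evalJet_jet, evalJet_smul]
  ring

theorem dx_pow_3_fn (f : Smooth I) : (dx ^ 3) (fn f) =
    fn (der f) * ((1 : ℝ) • (jet 2))
    + fn (der (der f)) * ((3 : ℝ) • (jet 0 * jet 1))
    + fn (der (der (der f))) * ((1 : ℝ) • (jet 0 ^ 3)) := by
  rw [dx_pow_succ, dx_pow_2_fn]
  refine ext_evalJet fun u x => ?_
  simp only [pow_succ, pow_zero, one_mul, dx_mul, dx_smul, dx_fn, dx_jet, map_add, map_mul,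
    evalJet_fn, evalJet_jet, evalJet_smul]
  ring

theorem dx_pow_4_fn (f : Smooth I) : (dx ^ 4) (fn f) =
    fn (der f) * ((1 : ℝ) • (jet 3))
    + fn (der (der f)) * ((4 : ℝ) • (jet 0 * jet 2) + (3 : ℝ) • (jet 1 ^ 2))
    + fn (der (der (der f))) * ((6 : ℝ) • (jet 0 ^ 2 * jet 1))
    + fn (der (der (der (der f)))) * ((1 : ℝ) • (jet 0 ^ 4)) := by
  rw [dx_pow_succ, dx_pow_3_fn]
  refine ext_evalJet fun u x => ?_
  simp only [pow_succ, pow_zero, one_mul, dx_mul, dx_smul, dx_fn, dx_jet, map_add, map_mul,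
    evalJet_fn, evalJet_jet, evalJet_smul]
  ring

theorem dx_pow_5_fn (f : Smooth I) : (dx ^ 5) (fn f) =
    fn (der f) * ((1 : ℝ) • (jet 4))
    + fn (der (der f)) * ((5 : ℝ) • (jet 0 * jet 3) + (10 : ℝ) • (jet 1 * jet 2))
    + fn (der (der (der f))) * ((15 : ℝ) • (jet 0 * jet 1 ^ 2) + (10 : ℝ) • (jet 0 ^ 2 * jet 2))
    + fn (der (der (der (der f)))) * ((10 : ℝ) • (jet 0 ^ 3 * jet 1))
    + fn (der (der (der (der (der f))))) * ((1 : ℝ) • (jet 0 ^ 5)) := by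
  rw [dx_pow_succ, dx_pow_4_fn]
  refine ext_evalJet fun u x => ?_
  simp only [pow_succ, pow_zero, one_mul, dx_mul, dx_smul, dx_fn, dx_jet, map_add, map_mul,
    evalJet_fn, evalJet_jet, evalJet_smul]
  ring

theorem dx_del2 (a : Smooth I) : dx (del2 a) =
    fn a * ((2 : ℝ) • (jet 2))
    + fn (der a) * ((4 : ℝ) • (jet 0 * jet 1))
    + fn (der (der a)) * ((1 : ℝ) • (jet 0 ^ 3)) := by
  rw [del2]
  refine ext_evalJet fun u x => ?_
  simp only [pow_succ, pow_zero, one_mul, dx_mul, dx_smul, dx_fn, dx_jet, map_add, map_mul,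
    evalJet_fn, evalJet_jet, evalJet_smul]
  ring

theorem dx_pow_2_del2 (a : Smooth I) : (dx ^ 2) (del2 a) =
    fn a * ((2 : ℝ) • (jet 3))
    + fn (der a) * ((6 : ℝ) • (jet 0 * jet 2) + (4 : ℝ) • (jet 1 ^ 2))
    + fn (der (der a)) * ((7 : ℝ) • (jet 0 ^ 2 * jet 1))
    + fn (der (der (der a))) * ((1 : ℝ) • (jet 0 ^ 4)) := by
  rw [dx_pow_succ, pow_one, dx_del2]
  refine ext_evalJet fun u x => ?_
  simp only [pow_succ, pow_zero, one_mul, dx_mul, dx_smul, dx_fn, dx_jet, map_add, map_mul,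
    evalJet_fn, evalJet_jet, evalJet_smul]
  ring

theorem dx_pow_3_del2 (a : Smooth I) : (dx ^ 3) (del2 a) =
    fn a * ((2 : ℝ) • (jet 4))
    + fn (der a) * ((8 : ℝ) • (jet 0 * jet 3) + (14 : ℝ) • (jet 1 * jet 2))
    + fn (der (der a)) * ((18 : ℝ) • (jet 0 * jet 1 ^ 2) + (13 : ℝ) • (jet 0 ^ 2 * jet 2))
    + fn (der (der (der a))) * ((11 : ℝ) • (jet 0 ^ 3 * jet 1))
    + fn (der (der (der (der a)))) * ((1 : ℝ) • (jet 0 ^ 5)) := by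
  rw [dx_pow_succ, dx_pow_2_del2]
  refine ext_evalJet fun u x => ?_
  simp only [pow_succ, pow_zero, one_mul, dx_mul, dx_smul, dx_fn, dx_jet, map_add, map_mul,
    evalJet_fn, evalJet_jet, evalJet_smul]
  ring

theorem dx_del4 (P R : Smooth I) : dx (del4 P R) =
    fn P * ((2 : ℝ) • (jet 4))
    + fn (der P) * ((6 : ℝ) • (jet 0 * jet 3) + (10 : ℝ) • (jet 1 * jet 2))
    + fn (der (der P)) * ((7 : ℝ) • (jet 0 * jet 1 ^ 2) + (6 : ℝ) • (jet 0 ^ 2 * jet 2))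
    + fn (der (der (der P))) * ((2 : ℝ) • (jet 0 ^ 3 * jet 1))
    + fn R * ((24 : ℝ) • (jet 0 * jet 1 ^ 2) + (12 : ℝ) • (jet 0 ^ 2 * jet 2))
    + fn (der R) * ((24 : ℝ) • (jet 0 ^ 3 * jet 1))
    + fn (der (der R)) * ((3 : ℝ) • (jet 0 ^ 5)) := by
  rw [del4]
  refine ext_evalJet fun u x => ?_
  simp only [pow_succ, pow_zero, one_mul, dx_mul, dx_smul, dx_fn, dx_jet, map_add, map_mul,
    evalJet_fn, evalJet_jet, evalJet_smul]
  ring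

/-- The differential operator of order less than `N` with given coefficients. -/
def ofCoeffs (N : ℕ) (a : ℕ → DiffPoly I) : DiffOp I := ∑ j ∈ Finset.range N, Finsupp.single j (a j)

theorem ofCoeffs_apply (N : ℕ) (a : ℕ → DiffPoly I) (j : ℕ) :
    ofCoeffs N a j = if j < N then a j else 0 := by
  rw [ofCoeffs, Finsupp.finsetSum_apply]
  simp only [Finsupp.single_apply]
  rw [Finset.sum_ite_eq']
  simp only [Finset.mem_range]

theorem ofCoeffs_act (N : ℕ) (a : ℕ → DiffPoly I) (F : DiffPoly I) :
    (ofCoeffs N a).act F = ∑ j ∈ Finset.range N, a j * (dx ^ j) F := by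
  induction N with
  | zero => exact act_zero_left F
  | succ N ih =>
    rw [Finset.sum_range_succ, ← ih, ofCoeffs, Finset.sum_range_succ, act_add_left, act_single]
    rfl

/-- The order `ε²` of the second bracket. -/
def opTwo (c q : Smooth I) : DiffOp I := ofCoeffs 4 (opTwoCoeff c q)

/-- The order `ε⁴` of the second bracket. -/
def opFour (c p s q : Smooth I) : DiffOp I := ofCoeffs 6 (opFourCoeff c p s q)

/-- The obstruction `½ p q' - c c' q' / 384 + c² q'' / 1920`. -/
def obstruction (c p q : Smooth I) : Smooth I :=
  (1 / 2 : ℝ) • (p * der q) - (1 / 384 : ℝ) • (c * der c * der q)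
    + (1 / 1920 : ℝ) • (c * c * der (der q))

/-- The defect of the recursion relation at order `ε⁴`, with `w` the obstruction. -/
def defect (w g : Smooth I) : DiffPoly I :=
  fn (der g * w) * jet 4 - (3 : ℝ) • (fn (der g * der w) * (jet 1 * jet 2))
    + (3 : ℝ) • (fn (der (der g) * w) * (jet 0 * jet 3))
    - (3 / 2 : ℝ) • (fn (der (der g) * der w) * (jet 0 * jet 1 ^ 2))
    + fn (der (der (der g)) * w) * ((2 : ℝ) • (jet 0 ^ 2 * jet 2) - jet 0 * jet 1 ^ 2)

/-- Here `g` stands for the leading gradient `g'`, and `recursionRHS q g` for `f''`. This identity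
is the purpose of the coefficients of `opTwo`; at this order it imposes no condition on `q`. -/
theorem recursion_second_order (c q g : Smooth I) :
    dx (del2 (hamA c (der (recursionRHS q g)))) =
      (secondOp q).act (del2 (hamA c (der (der g)))) + (opTwo c q).act (fn g) := by
  rw [secondOp_act, opTwo, ofCoeffs_act, dx_del2, dx_del2]
  simp only [Finset.sum_range_succ, Finset.sum_range_zero, pow_one, dx_fn, dx_pow_2_fn, dx_pow_3_fn,
    opTwoCoeff]
  refine ext_evalJet fun u x => ?_
  simp only [hamA, del2, recursionRHS, map_add, map_zero, map_mul, map_pow, evalJet_fn, evalJet_jet,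
    evalJet_smul, pow_zero, Module.End.one_apply, Smooth.der_add, Smooth.der_mul, Smooth.der_smul,
    Smooth.add_apply, Smooth.mul_apply, Smooth.smul_apply]
  ring

/-- The analogue for `opFour`, valid for all `c`, `p`, `s`, `q`. The defect is kept apart so that
the same identity serves both the existence and the necessity argument. -/
theorem recursion_fourth_order (c p s q g : Smooth I) :
    dx (del4 (hamP c p (der (recursionRHS q g))) (hamR c p s (der (recursionRHS q g)))) =
      (secondOp q).act (del4 (hamP c p (der (der g))) (hamR c p s (der (der g))))
        + (opTwo c q).act (del2 (hamA c (der (der g)))) + (opFour c p s q).act (fn g)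
        + defect (obstruction c p q) g := by
  rw [secondOp_act, opTwo, opFour, ofCoeffs_act, ofCoeffs_act, dx_del4, dx_del4]
  simp only [Finset.sum_range_succ, Finset.sum_range_zero, pow_one, dx_fn, dx_pow_2_fn, dx_pow_3_fn,
    dx_pow_4_fn, dx_pow_5_fn, dx_del2, dx_pow_2_del2, dx_pow_3_del2, opTwoCoeff, opFourCoeff]
  refine ext_evalJet fun u x => ?_
  simp only [hamA, hamP, hamR, del2, del4, defect, obstruction, recursionRHS, map_add, map_sub,
    map_zero, map_mul, evalJet_fn, evalJet_jet, evalJet_smul, pow_succ, pow_zero, one_mul,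
    Module.End.one_apply, Smooth.der_add, Smooth.der_sub, Smooth.der_mul, Smooth.der_smul,
    Smooth.add_apply, Smooth.sub_apply, Smooth.mul_apply, Smooth.smul_apply]
  ring

/-- The second bracket of the bihamiltonian structure with leading term given by `q`. -/
def opSeries (c p s q : Smooth I) : Ser (DiffOp I) :=
  ![secondOp q, 0, opTwo c q, 0, opFour c p s q, 0]

theorem isDeformation_opSeries (c p s q : Smooth I) :
    IsDeformation (secondOp q) (opSeries c p s q) := by
  refine isDeformation_of_leading rfl fun n hn j hj => ?_
  fin_cases n
  · exact absurd rfl hn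
  · exact absurd rfl hj
  · have h : opTwo c q j ≠ 0 := hj
    change ∃ d, d + j = 3 ∧ HasDegree (opTwo c q j) d
    rw [opTwo, ofCoeffs_apply] at h ⊢
    split_ifs with hlt
    · rw [if_pos hlt] at h
      exact hasDegree_opTwoCoeff c q j h
    · rw [if_neg hlt] at h
      exact absurd rfl h
  · exact absurd rfl hj
  · have h : opFour c p s q j ≠ 0 := hj
    change ∃ d, d + j = 5 ∧ HasDegree (opFour c p s q j) d
    rw [opFour, ofCoeffs_apply] at h ⊢
    split_ifs with hlt
    · rw [if_pos hlt] at h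
      exact hasDegree_opFourCoeff c p s q j h
    · rw [if_neg hlt] at h
      exact absurd rfl h
  · exact absurd rfl hj

theorem field_firstOp_ham {c p s q f g : Smooth I}
    (h : ∀ u, der (der f) u = q u * der (der g) u + 1 / 2 * der q u * der g u) (n : Fin 6) :
    field (firstOp I) (ham c p s f) n = field (opSeries c p s q) (ham c p s g) n
      + (![0, 0, 0, 0, defect (obstruction c p q) (der g), 0] : Ser (DiffPoly I)) n := by
  have hf : der (der f) = recursionRHS q (der g) :=
    Smooth.ext fun u => by simp [h u, recursionRHS, mul_assoc]
  have h0 := secondOp_act_eq h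
  rw [secondOp_one, act_single, pow_one, one_mul] at h0
  have e2 := recursion_second_order c q (der g)
  have e4 := recursion_fourth_order c p s q (der g)
  rw [← hf] at e2 e4
  have hE : field (opSeries c p s q) (ham c p s g) n = ∑ i : Fin 6, ∑ j : Fin 6,
      if (i : ℕ) + (j : ℕ) = n then (opSeries c p s q i).act (varD (ham c p s g j)) else 0 := rfl
  have g0 : ∀ f, varD (ham c p s f 0) = fn (der f) := fun f => varD_ham c p s f 0
  have g1 : ∀ f, varD (ham c p s f 1) = 0 := fun f => varD_ham c p s f 1
  have g2 : ∀ f, varD (ham c p s f 2) = del2 (hamA c (der (der (der f)))) :=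
    fun f => varD_ham c p s f 2
  have g3 : ∀ f, varD (ham c p s f 3) = 0 := fun f => varD_ham c p s f 3
  have g4 : ∀ f, varD (ham c p s f 4) = del4 (hamP c p (der (der (der f))))
      (hamR c p s (der (der (der f)))) := fun f => varD_ham c p s f 4
  have g5 : ∀ f, varD (ham c p s f 5) = 0 := fun f => varD_ham c p s f 5
  have l0 : opSeries c p s q 0 = secondOp q := rfl
  have l1 : opSeries c p s q 1 = 0 := rfl
  have l2 : opSeries c p s q 2 = opTwo c q := rfl
  have l3 : opSeries c p s q 3 = 0 := rfl
  have l4 : opSeries c p s q 4 = opFour c p s q := rfl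
  have l5 : opSeries c p s q 5 = 0 := rfl
  rw [hE, field_firstOp]
  simp only [Fin.sum_univ_six, l0, l1, l2, l3, l4, l5, g0, g1, g2, g3, g4, g5, act_zero_left,
    act_zero_right, ite_self, add_zero]
  fin_cases n
  · simpa [g0] using h0
  · simp [g1]
  · simpa [g2] using e2
  · simp [g3]
  · simpa [g4] using e4
  · simp [g5]

theorem defect_zero (g : Smooth I) : defect 0 g = 0 := by
  refine ext_evalJet fun u x => ?_
  simp [defect]

theorem bracket_congr {L M : Ser (DiffOp I)} {G K : Ser (DiffPoly I)} (h : field L G = field M K)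
    (F : Ser (DiffPoly I)) : bracket L F G = bracket M F K := by
  rw [bracket, bracket, h]

/-- With no defect, the second flow of `H_g` is the first flow of some `H_k`, and commutation is
inherited from the first bracket. -/
theorem commute_opSeries (hI : IsConnected (I : Set ℝ)) {c p s q : Smooth I}
    (hw : obstruction c p q = 0) (f g : Smooth I) :
    IsNull (bracket (opSeries c p s q) (ham c p s f) (ham c p s g)) := by
  obtain ⟨k, hk⟩ := exists_der_der_eq hI q g
  have : field (opSeries c p s q) (ham c p s g) = field (firstOp I) (ham c p s k) := by
    funext n
    rw [field_firstOp_ham hk, hw, defect_zero]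
    fin_cases n <;> simp
  rw [bracket_congr this]
  exact commute_first_ham hI c p s f k

theorem isBihamiltonian_of_commute (hI : IsConnected (I : Set ℝ)) {c p s q : Smooth I}
    {L : Ser (DiffOp I)} (hL : IsDeformation (secondOp q) L)
    (hc : ∀ f g, IsNull (bracket L (ham c p s f) (ham c p s g))) :
    IsBihamiltonian c p s q L where
  deformation := hL
  first := isPoisson_of_commute hI isDeformation_firstOp (fun _ => rfl) (commute_first_ham hI c p s)
  pencil l := by
    have h : L - l • firstOp I = (1 : ℝ) • L + (-l) • firstOp I := by
      funext n
      ext1 j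
      simp [sub_eq_add_neg]
    rw [h]
    refine isPoisson_of_commute hI (hL.smul_add 1 (-l)) (H := ham c p s) (fun _ => rfl)
      fun f g => ?_
    rw [bracket_smul_add]
    exact (hc f g).smul_add (commute_first_ham hI c p s f g) _ _
  commute_first := commute_first_ham hI c p s
  commute_second := hc

theorem IsBihamiltonian.field_eq (hI : IsConnected (I : Set ℝ)) {c p s q : Smooth I}
    {L : Ser (DiffOp I)} (h : IsBihamiltonian c p s q L) {f g : Smooth I}
    (hfg : ∀ u, der (der f) u = q u * der (der g) u + 1 / 2 * der q u * der g u) :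
    field (firstOp I) (ham c p s f) = field L (ham c p s g) :=
  field_eq_of_commute hI isDeformation_firstOp h.deformation (fun _ => rfl)
    (varD_ham_mem_degGE c p s) (fun k => h.commute_first k f) (fun k => h.commute_second k g)
    (secondOp_act_eq hfg)

theorem IsBihamiltonian.unique (hI : IsConnected (I : Set ℝ)) {c p s q : Smooth I}
    {L M : Ser (DiffOp I)} (hL : IsBihamiltonian c p s q L) (hM : IsBihamiltonian c p s q M) :
    L = M :=
  deformation_unique hI hL.deformation hM.deformation (fun _ => rfl) (varD_ham_mem_degGE c p s)
    hL.commute_second hM.commute_second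

/-! ### Necessity: the obstruction vanishes -/

theorem HasDegree.eq_fn {F : DiffPoly I} (h : HasDegree F 0) : ∃ b, F = fn b := by
  classical
  refine ⟨F.coeff 0, ?_⟩
  ext1 m
  rw [fn, MvPolynomial.coeff_C]
  split_ifs with hm
  · rw [hm]
  · by_contra hne
    have hw := h hne
    refine hm (Eq.symm (Finsupp.ext fun i => ?_))
    by_contra hi
    have := Finsupp.le_weight (fun n : ℕ => n + 1) (s := i) (by omega) m
    rw [hw] at this
    exact hi (by simpa using this)

theorem Smooth.divPow_zero (a : ℝ) : (Smooth.divPow a 0 : Smooth I) = 1 :=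
  Smooth.ext fun u => by simp [Smooth.divPow]

theorem atPoint_dx_pow_divPow (u : I) (j : ℕ) : atPoint u ((dx ^ j) (fn (Smooth.divPow u 1))) =
    if j = 0 then 0 else MvPolynomial.X (j - 1) := by
  rcases j with _ | j
  · rw [if_pos rfl, pow_zero, Module.End.one_apply, atPoint_fn, Smooth.divPow_apply_succ]
    simp
  · have : ∀ j, (dx ^ (j + 1)) (fn (Smooth.divPow u 1)) = (jet j : DiffPoly I) := fun j => by
      induction j with
      | zero =>
        rw [zero_add, pow_one, dx_fn, Smooth.der_divPow_succ, Smooth.divPow_zero, fn, map_one,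
          one_mul]
      | succ j ih => rw [dx_pow_succ, ih, dx_jet]
    rw [this, atPoint_jet, if_neg (by omega), Nat.add_sub_cancel]

/-- If the defect is the value of a homogeneous differential operator, the obstruction vanishes. -/
theorem obstruction_eq_zero {B : DiffOp I} {w : Smooth I}
    (hdeg : ∀ j, B j ≠ 0 → ∃ d, d + j = 5 ∧ HasDegree (B j) d)
    (h : ∀ g, B.act (fn g) = defect w g) : w = 0 := by
  have hs : ∀ F, B.act F = ∑ j ∈ Finset.range 6, B j * (dx ^ j) F := fun F => by
    rw [act_eq, Finsupp.sum_of_support_subset _ _ _ (by simp)]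
    intro j hj
    obtain ⟨d, hd, -⟩ := hdeg j (Finsupp.mem_support_iff.1 hj)
    exact Finset.mem_range.2 (by omega)
  obtain ⟨b, hb⟩ : ∃ b, B 5 = fn b := by
    by_cases h5 : B 5 = 0
    · exact ⟨0, by rw [h5, fn, map_zero]⟩
    · obtain ⟨d, hd, hF⟩ := hdeg 5 h5
      obtain rfl : d = 0 := by omega
      exact hF.eq_fn
  refine Smooth.ext fun u => ?_
  -- First test: `g = u - a` on the jet whose only nonzero variable is `u^{(5)} = 1`. Only `B 5` is
  -- seen on the left, and the defect equals `w`, so `b = w` at the point.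
  have h1 := congrArg (fun F => MvPolynomial.eval (Pi.single 4 1) (atPoint u F))
    (h (Smooth.divPow u 1))
  simp only [hs, map_add, map_mul, atPoint_dx_pow_divPow, Finset.sum_range_succ,
    Finset.sum_range_zero, hb, atPoint_fn] at h1
  have h1' : b u = w u := by
    have e : MvPolynomial.eval (Pi.single 4 1) (atPoint u (defect w (Smooth.divPow u 1)))
        = w u := by
      change evalJet u (Pi.single 4 1) _ = _
      simp [defect, Smooth.der_divPow_succ, Smooth.divPow_zero]
    rw [e] at h1
    simpa using h1
  have hd (j : ℕ) (F : DiffPoly I) : (dx ^ j) F = (-1) ^ j * ((-dx) ^ j) F := by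
    rw [neg_dx_pow, ← mul_assoc, ← mul_pow]; simp
  -- Second test: `g = (u - a)^5/5!` on the jet with only `u_x = 1`. The defect contains at most
  -- three derivatives of `g` and vanishes, while the operator gives `b`; hence `b = 0`.
  have h2 := congrArg (fun F => MvPolynomial.eval (Pi.single 0 1) (atPoint u F))
    (h (Smooth.divPow u 5))
  have e2 : MvPolynomial.eval (Pi.single 0 1) (atPoint u (defect w (Smooth.divPow u 5))) = 0 := by
    change evalJet u (Pi.single 0 1) _ = _
    simp [defect, Smooth.der_divPow_succ, Smooth.divPow_apply_succ]
  have h3 := atPoint_neg_dx_pow_divPow u 5 1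
  rw [mul_one] at h3
  simp only [hs, Finset.sum_range_succ _ 5, map_add, map_sum, map_mul, e2, hd, h3, hb,
    atPoint_fn] at h2
  rw [Finset.sum_eq_zero] at h2
  · have h4 : b u = 0 := by simpa using h2
    rw [← h1', h4, Smooth.zero_apply]
  · intro j hj
    have := atPoint_neg_dx_pow_divPow_of_lt u (Finset.mem_range.1 hj) 1
    rw [mul_one] at this
    rw [this, map_zero, mul_zero, mul_zero]

theorem IsBihamiltonian.obstruction_eq_zero (hI : IsConnected (I : Set ℝ)) {c p s q : Smooth I}
    {L : Ser (DiffOp I)} (h : IsBihamiltonian c p s q L) : obstruction c p q = 0 := by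
  have hE : ∀ (g : Smooth I) (n : Fin 6), field L (ham c p s g) n =
      field (opSeries c p s q) (ham c p s g) n
      + (![0, 0, 0, 0, defect (obstruction c p q) (der g), 0] : Ser (DiffPoly I)) n := by
    intro g n
    obtain ⟨f, hf⟩ := exists_der_der_eq hI q g
    rw [← h.field_eq hI hf, field_firstOp_ham hf]
  -- The defect enters only at order four, so `L` agrees with the explicit series below that order,
  -- and at order four their difference maps `g'` to the defect.
  have hlow := eq_of_field_eq (L := L) (M := opSeries c p s q) (H := ham c p s) hI (fun _ => rfl)
    (N := 4) (fun g n hn => by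
      rw [hE]
      fin_cases n <;> simp at hn ⊢)
  refine BiHam.obstruction_eq_zero (B := L 4 - opSeries c p s q 4) (fun j hj => ?_) fun g' => ?_
  · rw [Finsupp.sub_apply] at hj ⊢
    by_cases h5 : j ≤ 5
    · have key : ∀ {M : Ser (DiffOp I)}, IsDeformation (secondOp q) M →
          HasDegree (M 4 j) (5 - j) := by
        intro M hM
        by_cases h0 : M 4 j = 0
        · rw [h0]
          exact MvPolynomial.isWeightedHomogeneous_zero _ _ _
        · obtain ⟨d, hd, hF⟩ := hM.graded 4 j h0
          obtain rfl : d = 5 - j := by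
            have : ((4 : Fin 6) : ℕ) = 4 := rfl
            omega
          exact hF
      exact ⟨5 - j, by omega, MvPolynomial.IsWeightedHomogeneous.sub (key h.deformation)
        (key (isDeformation_opSeries c p s q))⟩
    · have h4 : ((4 : Fin 6) : ℕ) = 4 := rfl
      rw [((h.deformation.opDeg 4) j).2 (by omega),
        (((isDeformation_opSeries c p s q).opDeg 4) j).2 (by omega), sub_zero] at hj
      exact absurd rfl hj
  · obtain ⟨g, rfl⟩ := Smooth.exists_der_eq hI g'
    have := field_sub_of_eq (L := L) (M := opSeries c p s q) (n := 4)
      (fun k hk => hlow k (Fin.lt_def.1 hk)) (ham c p s g)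
    rw [hE, add_sub_cancel_left, show ham c p s g 0 = fn g from rfl, varD_fn] at this
    exact this.symm

/-! ### The differential equation for `q` -/

theorem obstruction_eq_zero_iff {c p q : Smooth I} (hc : ∀ u, c u ≠ 0) (hq : ∀ u, der q u ≠ 0) :
    obstruction c p q = 0 ↔
      ∀ u, p u = c u ^ 2 / 960 * (5 * (der c u / c u) - der (der q) u / der q u) := by
  have h : ∀ u, obstruction c p q u = 0 ↔
      p u = c u ^ 2 / 960 * (5 * (der c u / c u) - der (der q) u / der q u) := by
    intro u
    have h1 := hc u
    have h2 := hq u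
    -- Solving the obstruction `w` for `p`: the required value differs from `p` by `2 w / q'`.
    have e : c u ^ 2 / 960 * (5 * (der c u / c u) - der (der q) u / der q u) =
        p u - 2 * obstruction c p q u / der q u := by
      simp only [obstruction, Smooth.add_apply, Smooth.sub_apply, Smooth.mul_apply,
        Smooth.smul_apply]
      field_simp
      ring
    rw [e, eq_sub_iff_add_eq, add_eq_left, div_eq_zero_iff]
    simp [h2]
  constructor
  · intro h0 u
    rw [← h, h0, Smooth.zero_apply]
  · exact fun h0 => Smooth.ext fun u => (h u).2 (h0 u)

theorem exists_isBihamiltonian (hI : IsConnected (I : Set ℝ)) {c p q : Smooth I} (s : Smooth I)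
    (hw : obstruction c p q = 0) : ∃ L, IsBihamiltonian c p s q L :=
  ⟨opSeries c p s q, isBihamiltonian_of_commute hI (isDeformation_opSeries c p s q)
    (commute_opSeries hI hw)⟩

theorem exists_obstruction_eq_zero (hI : IsConnected (I : Set ℝ)) {c : Smooth I} (p : Smooth I)
    (hc : ∀ u, c u ≠ 0) : ∃ q : Smooth I, (∀ u, der q u ≠ 0) ∧ obstruction c p q = 0 := by
  obtain ⟨d, hd⟩ := Smooth.exists_mul_eq_one hc
  -- With `d = 1/c`, vanishing obstruction reads `q''/q' = 5 c'/c - 960 p/c²`. Here `k` is a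
  -- primitive of the right-hand side, and `q' = exp k` has no zeros.
  obtain ⟨k, hk⟩ := Smooth.exists_der_eq hI ((5 : ℝ) • (der c * d) - (960 : ℝ) • (p * d ^ 2))
  obtain ⟨e, he, hde⟩ := Smooth.exists_exp k
  obtain ⟨q, rfl⟩ := Smooth.exists_der_eq hI e
  refine ⟨q, he, Smooth.ext fun u => ?_⟩
  have h1 : c u * d u = 1 := by rw [← Smooth.mul_apply, hd, Smooth.one_apply]
  rw [obstruction, hde, hk]
  simp only [Smooth.add_apply, Smooth.sub_apply, Smooth.mul_apply, Smooth.smul_apply,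
    Smooth.pow_apply, Smooth.zero_apply]
  linear_combination ((1 / 384 : ℝ) * c u * der c u * der q u
    - (1 / 2 : ℝ) * p u * der q u * (c u * d u + 1)) * h1

theorem exists_affine (hI : IsConnected (I : Set ℝ)) {c p q r : Smooth I} (hc : ∀ u, c u ≠ 0)
    (hq : ∀ u, der q u ≠ 0) (hr : ∀ u, der r u ≠ 0) (hwq : obstruction c p q = 0)
    (hwr : obstruction c p r = 0) :
    ∃ a b : ℝ, a ≠ 0 ∧ r = a • q + algebraMap ℝ _ b := by
  obtain ⟨d, hd⟩ := Smooth.exists_mul_eq_one hq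
  -- Both functions satisfy the same linear equation for their derivatives, so the Wronskian of `q'`
  -- and `r'` vanishes and `r'/q'` is constant.
  have hw : der (der r) * der q = der r * der (der q) := by
    refine Smooth.ext fun u => ?_
    have e1 := congrArg (fun F => Smooth.evalHom u F) hwq
    have e2 := congrArg (fun F => Smooth.evalHom u F) hwr
    simp only [obstruction, Smooth.evalHom_apply, Smooth.add_apply, Smooth.sub_apply,
      Smooth.mul_apply, Smooth.smul_apply, Smooth.zero_apply] at e1 e2
    refine mul_left_cancel₀ (pow_ne_zero 2 (hc u)) ?_
    simp only [Smooth.mul_apply]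
    linear_combination 1920 * der q u * e2 - 1920 * der r u * e1
  have hdd : der d = -(d * d * der (der q)) := by
    have h1 := congrArg der hd
    rw [Smooth.der_mul, Smooth.der_one] at h1
    have h2 := congrArg (d * ·) h1
    simp only [mul_zero] at h2
    linear_combination h2 - der d * hd
  obtain ⟨a, ha⟩ := Smooth.exists_eq_of_der_eq_zero hI (f := der r * d) (by
    rw [Smooth.der_mul, hdd]
    linear_combination d * d * hw - d * der (der r) * hd)
  have hra : der r = a • der q := by
    rw [Algebra.smul_def, ← ha]
    linear_combination -der r * hd
  obtain ⟨b, hb⟩ := Smooth.exists_eq_of_der_eq_zero hI (f := r - a • q) (by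
    rw [Smooth.der_sub, Smooth.der_smul, hra, sub_self])
  refine ⟨a, b, ?_, ?_⟩
  · rintro rfl
    obtain ⟨u, hu⟩ := hI.nonempty
    exact hr ⟨u, hu⟩ (by rw [hra, Smooth.smul_apply, zero_mul])
  · rw [← hb]; abel

end

end BiHam

open BiHam in
theorem mainTheorem5 (I : TopologicalSpace.Opens ℝ) (hI : IsConnected (I : Set ℝ))
    (c p s : Smooth I) (hc : ∀ u, c u ≠ 0) :
    -- for a given `q`: existence criterion and uniqueness
    (∀ q : Smooth I, (∀ u, der q u ≠ 0) →
      ((∃ L, IsBihamiltonian c p s q L) ↔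
        ∀ u, p u = c u ^ 2 / 960 * (5 * (der c u / c u) - der (der q) u / der q u)) ∧
      ((∀ u, p u = c u ^ 2 / 960 * (5 * (der c u / c u) - der (der q) u / der q u)) →
        ∃! L, IsBihamiltonian c p s q L)) ∧
    -- for given Hamiltonians there is such a `q`, and the resulting pencil is unique
    (∃ q : Smooth I, (∀ u, der q u ≠ 0) ∧ ∃ L, IsBihamiltonian c p s q L) ∧
    (∀ q r : Smooth I, (∀ u, der q u ≠ 0) → (∀ u, der r u ≠ 0) →
      ∀ L M, IsBihamiltonian c p s q L → IsBihamiltonian c p s r M →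
        ∃ a b : ℝ, a ≠ 0 ∧ (∀ u, r u = a * q u + b) ∧ M = a • L + b • firstOp I) ∧
    -- the flows are Hamiltonian with respect to both brackets
    (∀ q : Smooth I, (∀ u, der q u ≠ 0) → ∀ L, IsBihamiltonian c p s q L →
      ∀ f g : Smooth I,
        (∀ u, der (der f) u = q u * der (der g) u + 1 / 2 * der q u * der g u) →
        field (firstOp I) (ham c p s f) = field L (ham c p s g)) := by
  refine ⟨fun q hq => ?_, ?_, fun q r hq hr L M hL hM => ?_, fun q _ L hL f g h => hL.field_eq hI h⟩
  · refine ⟨⟨fun ⟨L, hL⟩ => (obstruction_eq_zero_iff hc hq).1 (hL.obstruction_eq_zero hI),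
      fun h => exists_isBihamiltonian hI s ((obstruction_eq_zero_iff hc hq).2 h)⟩, fun h => ?_⟩
    obtain ⟨L, hL⟩ := exists_isBihamiltonian hI s ((obstruction_eq_zero_iff hc hq).2 h)
    exact ⟨L, hL, fun M hM => hM.unique hI hL⟩
  · obtain ⟨q, hq, hw⟩ := exists_obstruction_eq_zero hI p hc
    exact ⟨q, hq, exists_isBihamiltonian hI s hw⟩
  · obtain ⟨a, b, ha, rfl⟩ :=
      exists_affine hI hc hq hr (hL.obstruction_eq_zero hI) (hM.obstruction_eq_zero hI)
    refine ⟨a, b, ha, fun u => rfl, hM.unique hI ?_⟩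
    -- The operator `a L + b ∂_x` deforms the bracket of `a q + b` and keeps the Hamiltonians in
    -- involution, so it is a structure for `r`; uniqueness identifies it with `M`.
    refine isBihamiltonian_of_commute hI (hL.deformation.smul_add a b) fun f g => ?_
    rw [bracket_smul_add]
    exact (hL.commute_second f g).smul_add (hL.commute_first f g) a b
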